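/- Let $d\in\mathbb N$ and $\alpha>1$. Set $$\Omega_\alpha=\{a+ib\in\mathbb C^d : a,b\in\mathbb R^d,\ |a|+\alpha|b|<1\},$$ where $|\cdot|$ is the Euclidean norm, and let $X_\alpha$ be the space of bounded uniformly continuous functions $f:\mathbb R^d\to\mathbb C$ whose restriction to the open unit ball of $\mathbb R^d$ admits a continuous extension $f_e$ to $\overline{\Omega_\alpha}$ which is holomorphic on $\Omega_\alpha$; it is a Banach space for the norm $$\|f\|_{X_\alpha}=\|f\|_{L^\infty(\mathbb R^d)}+\|f_e\|_{L^\infty(\Omega_\alpha)}.$$ Let $\mathbb T=(\mathbb T_t)_{t\ge0}$ be the heat semigroup on $\mathbb R^d$: $\mathbb T_0y_0=y_0$ and, for $t>0$, $$(\mathbb T_ty_0)(x)=\int_{\mathbb R^d}\frac{1}{(4\pi t)^{d/2}}\,e^{-|x-x_0|^2/(4t)}\,y_0(x_0)\,dx_0 .$$ Then $\mathbb T$ is an analytic semigroup on $X_\alpha$. That is, the operators $\mathbb T_t$ are bounded linear operators on $X_\alpha$ which form a strongly continuous semigroup, and for some $\theta\in(0,\pi/2]$ this semigroup extends to a family $(\mathbb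 T_z)$ of bounded operators on $X_\alpha$, for $z=0$ and for $z$ in the sector $\Sigma_\theta=\{z\in\mathbb C\setminus\{0\}:|\arg z|<\theta\}$, such that $\mathbb T_{z+w}=\mathbb T_z\mathbb T_w$ for $z,w\in\Sigma_\theta$, the map $z\mapsto\mathbb T_z$ is holomorphic on $\Sigma_\theta$ in operator norm, and $\mathbb T_zy\to y$ in $X_\alpha$ as $z\to0$ in $\Sigma_{\theta'}$, for all $y\in X_\alpha$ and $0<\theta'<\theta$. Moreover, there exists a constant $C>0$ (depending only on $d$ and $\alpha$) such that for all $t>0$ and all $y_0\in X_\alpha$, the function $\mathbb T_ty_0$ is of class $C^1$ on $\mathbb R^d$, its partial derivatives $\partial_j(\mathbb T_ty_0)$ belong to $X_\alpha$, and $$\|\mathbb T_ty_0\|_{X_\alpha}+\sqrt t\,\|\nabla_x(\mathbb T_ty_0)\|_{X_\alpha}\le C\|y_0\|_{X_\alpha},\qquad\text{where } \|\nabla_x f\|_{X_\alpha}=\sum_{j=1}^d\|\partial_jf\|_{X_\alpha}.$$ -/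

import Mathlib

open Set Filter Topology MeasureTheory
open scoped NNReal BoundedContinuousFunction

noncomputable section

namespace HeatHol

/-! ## The complex domain `Ω_α` and the space `X_α` -/

/-- The vector `a ∈ ℝ^d` of real parts of `z = a + i b ∈ ℂ^d`. -/
def reVec {d : ℕ} (z : EuclideanSpace ℂ (Fin d)) : EuclideanSpace ℝ (Fin d) :=
  WithLp.toLp 2 fun j => (z j).re

/-- The vector `b ∈ ℝ^d` of imaginary parts of `z = a + i b ∈ ℂ^d`. -/
def imVec {d : ℕ} (z : EuclideanSpace ℂ (Fin d)) : EuclideanSpace ℝ (Fin d) :=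
  WithLp.toLp 2 fun j => (z j).im

/-- The inclusion `ℝ^d ⊆ ℂ^d`. -/
def toComplex {d : ℕ} (x : EuclideanSpace ℝ (Fin d)) : EuclideanSpace ℂ (Fin d) :=
  WithLp.toLp 2 fun j => (x j : ℂ)

/-- `Ω_α = {a + i b : a, b ∈ ℝ^d, |a| + α |b| < 1}`, with the Euclidean norm `|·|` of `ℝ^d`. -/
def Omega (d : ℕ) (α : ℝ) : Set (EuclideanSpace ℂ (Fin d)) :=
  {z | ‖reVec z‖ + α * ‖imVec z‖ < 1}

/-- `F` is continuous on the closure of `Ω_α`, holomorphic on `Ω_α`, and extends the restriction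
of `f : ℝ^d → ℂ` to the open unit ball. -/
structure IsHolExtension (d : ℕ) (α : ℝ) (f : EuclideanSpace ℝ (Fin d) → ℂ)
    (F : EuclideanSpace ℂ (Fin d) → ℂ) : Prop where
  continuousOn : ContinuousOn F (closure (Omega d α))
  holomorphic : DifferentiableOn ℂ F (Omega d α)
  extends_ball : ∀ x ∈ Metric.ball (0 : EuclideanSpace ℝ (Fin d)) 1, F (toComplex x) = f x

/-- `X_α` as a linear subspace of the bounded continuous functions on `ℝ^d`: the (bounded)
uniformly continuous functions whose restriction to the unit ball has an extension as above. -/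
def holSubmodule (d : ℕ) (α : ℝ) : Submodule ℂ (EuclideanSpace ℝ (Fin d) →ᵇ ℂ) where
  carrier := {f | UniformContinuous f ∧ ∃ F, IsHolExtension d α f F}
  zero_mem' := ⟨uniformContinuous_const, fun _ => 0,
    ⟨continuousOn_const, differentiableOn_const _, fun _ _ => rfl⟩⟩
  add_mem' := by
    rintro f g ⟨hf, F, hF⟩ ⟨hg, G, hG⟩
    exact ⟨hf.add hg, fun z => F z + G z, hF.continuousOn.add hG.continuousOn,
      hF.holomorphic.add hG.holomorphic, fun x hx => by
        simp [hF.extends_ball x hx, hG.extends_ball x hx]⟩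
  smul_mem' := by
    rintro c f ⟨hf, F, hF⟩
    exact ⟨hf.const_smul c, fun z => c • F z, hF.continuousOn.const_smul c,
      hF.holomorphic.const_smul c, fun x hx => by simp [hF.extends_ball x hx]⟩

/-- The space `X_α(ℝ^d)`, for `α > 0`. This is a type of its own, because it does not carry the
norm it would inherit from the bounded continuous functions. -/
def XSpace (d : ℕ) (α : ℝ) (_hα : 0 < α) : Type := holSubmodule d α

namespace XSpace

variable {d : ℕ} {α : ℝ} {hα : 0 < α}

instance : AddCommGroup (XSpace d α hα) := inferInstanceAs (AddCommGroup (holSubmodule d α))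

instance : Module ℂ (XSpace d α hα) := inferInstanceAs (Module ℂ (holSubmodule d α))

/-- The underlying bounded continuous function of an element of `X_α`. -/
def toBCF (f : XSpace d α hα) : EuclideanSpace ℝ (Fin d) →ᵇ ℂ := f.1

instance : CoeFun (XSpace d α hα) fun _ => EuclideanSpace ℝ (Fin d) → ℂ := ⟨fun f => f.toBCF⟩

/-- The extension `f_e` of `f ∈ X_α`. It is unique on the closure of `Ω_α`, see `ext_eqOn`; its
values elsewhere are irrelevant. -/
def ext (f : XSpace d α hα) : EuclideanSpace ℂ (Fin d) → ℂ := f.2.2.choose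

theorem isHolExtension_ext (f : XSpace d α hα) : IsHolExtension d α f f.ext := f.2.2.choose_spec

/-- `‖f‖ = sup_{ℝ^d} |f| + sup_{Ω_α} |f_e|`. -/
instance : Norm (XSpace d α hα) :=
  ⟨fun f => ‖f.toBCF‖ + ⨆ z : Omega d α, ‖f.ext (z : EuclideanSpace ℂ (Fin d))‖⟩

theorem norm_def (f : XSpace d α hα) :
    ‖f‖ = ‖f.toBCF‖ + ⨆ z : Omega d α, ‖f.ext (z : EuclideanSpace ℂ (Fin d))‖ := rfl

end XSpace

/-! ### Uniqueness of the extension -/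

theorem continuous_reVec {d : ℕ} : Continuous (reVec (d := d)) := by
  unfold reVec; fun_prop

theorem continuous_imVec {d : ℕ} : Continuous (imVec (d := d)) := by
  unfold imVec; fun_prop

theorem isOpen_Omega (d : ℕ) (α : ℝ) : IsOpen (Omega d α) :=
  isOpen_lt (continuous_reVec.norm.add (continuous_const.mul continuous_imVec.norm))
    continuous_const

theorem norm_le_reVec_imVec {d : ℕ} (z : EuclideanSpace ℂ (Fin d)) :
    ‖z‖ ≤ ‖reVec z‖ + ‖imVec z‖ := by
  rw [← abs_of_nonneg (norm_nonneg z),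
    ← abs_of_nonneg (add_nonneg (norm_nonneg (reVec z)) (norm_nonneg (imVec z)))]
  apply sq_le_sq.mp
  have h : ‖z‖ ^ 2 = ‖reVec z‖ ^ 2 + ‖imVec z‖ ^ 2 := by
    simp only [EuclideanSpace.norm_sq_eq, ← Finset.sum_add_distrib]
    refine Finset.sum_congr rfl fun j _ => ?_
    simp only [reVec, imVec, Real.norm_eq_abs, sq_abs]
    rw [← Complex.normSq_eq_norm_sq, Complex.normSq_apply]
    ring
  nlinarith [norm_nonneg (reVec z), norm_nonneg (imVec z)]

theorem isCompact_closure_Omega (d : ℕ) {α : ℝ} (hα : 0 < α) :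
    IsCompact (closure (Omega d α)) := by
  refine Bornology.IsBounded.isCompact_closure ?_
  refine (Metric.isBounded_ball (x := (0 : EuclideanSpace ℂ (Fin d))) (r := 1 + 1 / α + 1)).subset
    fun z hz => ?_
  have hz' : ‖reVec z‖ + α * ‖imVec z‖ < 1 := hz
  have h1 : ‖reVec z‖ ≤ 1 := by nlinarith [norm_nonneg (imVec z), norm_nonneg (reVec z)]
  have h2 : ‖imVec z‖ ≤ 1 / α := by
    rw [le_div_iff₀ hα]; nlinarith [norm_nonneg (reVec z)]
  rw [mem_ball_zero_iff]
  linarith [norm_le_reVec_imVec z]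

theorem IsHolExtension.eqOn_Omega {d : ℕ} {α : ℝ} (hα : 0 < α)
    {f : EuclideanSpace ℝ (Fin d) → ℂ} {F G : EuclideanSpace ℂ (Fin d) → ℂ}
    (hF : IsHolExtension d α f F) (hG : IsHolExtension d α f G) : EqOn F G (Omega d α) := by
  intro z hz
  have hz' : ‖reVec z‖ + α * ‖imVec z‖ < 1 := hz
  set a := reVec z with ha
  set b := imVec z with hb
  let L : ℂ → EuclideanSpace ℂ (Fin d) := fun w => toComplex a + w • toComplex b
  let W : Set ℂ := {w | ‖a + w.re • b‖ + α * ‖w.im • b‖ < 1}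
  have hre : ∀ w, reVec (L w) = a + w.re • b := by
    intro w; ext j; simp [L, reVec, toComplex]
  have him : ∀ w, imVec (L w) = w.im • b := by
    intro w; ext j; simp [L, imVec, toComplex]
  have hLW : ∀ w ∈ W, L w ∈ Omega d α := by
    intro w hw
    change ‖reVec (L w)‖ + α * ‖imVec (L w)‖ < 1
    rw [hre, him]; exact hw
  have hWo : IsOpen W := by
    refine isOpen_lt ?_ continuous_const
    have := Complex.continuous_re
    have := Complex.continuous_im
    fun_prop
  have hWc : Convex ℝ W := by
    intro x hx y hy s t hs ht hst
    have hx' : ‖a + x.re • b‖ + α * ‖x.im • b‖ < 1 := hx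
    have hy' : ‖a + y.re • b‖ + α * ‖y.im • b‖ < 1 := hy
    change ‖a + (s • x + t • y).re • b‖ + α * ‖(s • x + t • y).im • b‖ < 1
    have e1 : a + (s • x + t • y).re • b = s • (a + x.re • b) + t • (a + y.re • b) := by
      have : a = (s + t) • a := by rw [hst, one_smul]
      conv_lhs => rw [this]
      simp only [Complex.add_re, Complex.real_smul, Complex.re_ofReal_mul]
      module
    have e2 : (s • x + t • y).im • b = s • (x.im • b) + t • (y.im • b) := by
      simp only [Complex.add_im, Complex.real_smul, Complex.im_ofReal_mul]
      module
    rw [e1, e2]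
    have n1 := norm_add_le (s • (a + x.re • b)) (t • (a + y.re • b))
    have n2 := norm_add_le (s • (x.im • b)) (t • (y.im • b))
    rw [norm_smul, norm_smul, Real.norm_of_nonneg hs, Real.norm_of_nonneg ht] at n1
    rw [norm_smul s, norm_smul t, Real.norm_of_nonneg hs, Real.norm_of_nonneg ht] at n2
    have n3 := mul_le_mul_of_nonneg_left n2 hα.le
    rcases hs.eq_or_lt with h0 | h0
    · have : t = 1 := by linarith
      subst this; subst h0; linarith
    · nlinarith [mul_lt_mul_of_pos_left hx' h0, mul_le_mul_of_nonneg_left hy'.le ht]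
  have hLd : Differentiable ℂ L := by
    intro w
    exact (differentiableAt_const _).add (differentiableAt_id.smul_const _)
  have hd : DifferentiableOn ℂ (fun w => F (L w) - G (L w)) W :=
    (hF.holomorphic.comp hLd.differentiableOn hLW).sub
      (hG.holomorphic.comp hLd.differentiableOn hLW)
  have ha1 : ‖a‖ < 1 := by nlinarith [norm_nonneg b]
  have h0W : (0 : ℂ) ∈ W := by simpa [W] using ha1
  have hIW : Complex.I ∈ W := by simpa [W] using hz'
  have hfreq : ∃ᶠ w in 𝓝[≠] (0 : ℂ), F (L w) - G (L w) = 0 := by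
    have hev : ∀ᶠ r : ℝ in 𝓝[≠] 0, F (L r) - G (L r) = 0 := by
      have : ∀ᶠ r : ℝ in 𝓝 0, a + r • b ∈ Metric.ball (0 : EuclideanSpace ℝ (Fin d)) 1 := by
        have hc : Continuous fun r : ℝ => a + r • b := by fun_prop
        exact hc.continuousAt.eventually_mem (Metric.isOpen_ball.mem_nhds (by simpa using ha1))
      filter_upwards [this.filter_mono nhdsWithin_le_nhds] with r hr
      have : L r = toComplex (a + r • b) := by ext j; simp [L, toComplex]
      rw [this, hF.extends_ball _ hr, hG.extends_ball _ hr, sub_self]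
    have ht : Tendsto (fun r : ℝ => (r : ℂ)) (𝓝[≠] 0) (𝓝[≠] 0) := by
      refine tendsto_nhdsWithin_iff.mpr ⟨?_, ?_⟩
      · exact (Complex.continuous_ofReal.tendsto' 0 0 (by simp)).mono_left nhdsWithin_le_nhds
      · filter_upwards [self_mem_nhdsWithin] with r hr
        simpa using hr
    exact ht.frequently hev.frequently
  have key := (hd.analyticOnNhd hWo).eqOn_zero_of_preconnected_of_frequently_eq_zero
    hWc.isPreconnected h0W hfreq hIW
  have hLI : L Complex.I = z := by
    ext j
    simp only [L, toComplex, ha, hb, reVec, imVec, PiLp.add_apply, PiLp.smul_apply, smul_eq_mul]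
    rw [mul_comm]; exact Complex.re_add_im _
  simp only [hLI, Pi.zero_apply] at key
  exact sub_eq_zero.mp key

/-- The extension is unique. -/
theorem IsHolExtension.eqOn {d : ℕ} {α : ℝ} (hα : 0 < α)
    {f : EuclideanSpace ℝ (Fin d) → ℂ} {F G : EuclideanSpace ℂ (Fin d) → ℂ}
    (hF : IsHolExtension d α f F) (hG : IsHolExtension d α f G) :
    EqOn F G (closure (Omega d α)) :=
  (hF.eqOn_Omega hα hG).of_subset_closure hF.continuousOn hG.continuousOn subset_closure
    subset_rfl

/-! ### `X_α` is a Banach space -/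

namespace XSpace

variable {d : ℕ} {α : ℝ} {hα : 0 < α}

theorem ext_eqOn (f : XSpace d α hα) {F : EuclideanSpace ℂ (Fin d) → ℂ}
    (hF : IsHolExtension d α f F) : EqOn f.ext F (closure (Omega d α)) :=
  f.isHolExtension_ext.eqOn hα hF

theorem norm_ext_le_iSup (f : XSpace d α hα) {z : EuclideanSpace ℂ (Fin d)}
    (hz : z ∈ closure (Omega d α)) :
    ‖f.ext z‖ ≤ ⨆ z : Omega d α, ‖f.ext (z : EuclideanSpace ℂ (Fin d))‖ := by
  have hbdd : BddAbove (range fun z : Omega d α => ‖f.ext (z : EuclideanSpace ℂ (Fin d))‖) := by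
    obtain ⟨C, hC⟩ := (isCompact_closure_Omega d hα).exists_bound_of_continuousOn
      f.isHolExtension_ext.continuousOn
    exact ⟨C, by rintro _ ⟨z, rfl⟩; exact hC z (subset_closure z.2)⟩
  have hcl : ∀ z ∈ Omega d α,
      ‖f.ext z‖ ≤ ⨆ z : Omega d α, ‖f.ext (z : EuclideanSpace ℂ (Fin d))‖ :=
    fun z hz => le_ciSup hbdd ⟨z, hz⟩
  exact le_on_closure hcl f.isHolExtension_ext.continuousOn.norm continuousOn_const hz

theorem iSup_norm_ext_nonneg (f : XSpace d α hα) :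
    0 ≤ ⨆ z : Omega d α, ‖f.ext (z : EuclideanSpace ℂ (Fin d))‖ :=
  Real.iSup_nonneg fun _ => norm_nonneg _

theorem ext_add (f g : XSpace d α hα) {z : EuclideanSpace ℂ (Fin d)}
    (hz : z ∈ closure (Omega d α)) : (f + g).ext z = f.ext z + g.ext z :=
  (f + g).ext_eqOn (F := fun z => f.ext z + g.ext z)
    ⟨f.isHolExtension_ext.continuousOn.add g.isHolExtension_ext.continuousOn,
      f.isHolExtension_ext.holomorphic.add g.isHolExtension_ext.holomorphic, fun x hx => by
        rw [f.isHolExtension_ext.extends_ball x hx, g.isHolExtension_ext.extends_ball x hx]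
        rfl⟩ hz

theorem ext_smul (c : ℂ) (f : XSpace d α hα) {z : EuclideanSpace ℂ (Fin d)}
    (hz : z ∈ closure (Omega d α)) : (c • f).ext z = c * f.ext z :=
  (c • f).ext_eqOn (F := fun z => c * f.ext z)
    ⟨f.isHolExtension_ext.continuousOn.const_smul c,
      f.isHolExtension_ext.holomorphic.const_smul c, fun x hx => by
        rw [f.isHolExtension_ext.extends_ball x hx]
        rfl⟩ hz

theorem normedSpaceCore : NormedSpace.Core ℂ (XSpace d α hα) where
  norm_nonneg f := add_nonneg (norm_nonneg _) f.iSup_norm_ext_nonneg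
  norm_smul c f := by
    have h1 : (c • f).toBCF = c • f.toBCF := rfl
    have h2 : (⨆ z : Omega d α, ‖(c • f).ext (z : EuclideanSpace ℂ (Fin d))‖)
        = ‖c‖ * ⨆ z : Omega d α, ‖f.ext (z : EuclideanSpace ℂ (Fin d))‖ := by
      rw [Real.mul_iSup_of_nonneg (norm_nonneg c)]
      exact iSup_congr fun z => by rw [ext_smul c f (subset_closure z.2), norm_mul]
    rw [norm_def, norm_def, h1, h2, norm_smul, mul_add]
  norm_triangle f g := by
    have h1 : (f + g).toBCF = f.toBCF + g.toBCF := rfl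
    have h2 : (⨆ z : Omega d α, ‖(f + g).ext (z : EuclideanSpace ℂ (Fin d))‖)
        ≤ (⨆ z : Omega d α, ‖f.ext (z : EuclideanSpace ℂ (Fin d))‖)
          + ⨆ z : Omega d α, ‖g.ext (z : EuclideanSpace ℂ (Fin d))‖ := by
      refine Real.iSup_le (fun z => ?_) (add_nonneg f.iSup_norm_ext_nonneg g.iSup_norm_ext_nonneg)
      rw [ext_add f g (subset_closure z.2)]
      exact (norm_add_le _ _).trans (add_le_add (f.norm_ext_le_iSup (subset_closure z.2))
        (g.norm_ext_le_iSup (subset_closure z.2)))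
    rw [norm_def, norm_def, norm_def, h1]
    linarith [norm_add_le f.toBCF g.toBCF]
  norm_eq_zero_iff f := by
    constructor
    · intro h
      rw [norm_def] at h
      have h0 : ‖f.toBCF‖ = 0 := by
        linarith [norm_nonneg f.toBCF, f.iSup_norm_ext_nonneg]
      exact Subtype.ext (norm_eq_zero.mp h0)
    · rintro rfl
      have h1 : (0 : XSpace d α hα).toBCF = 0 := rfl
      have h2 : ∀ z : Omega d α, ‖(0 : XSpace d α hα).ext (z : EuclideanSpace ℂ (Fin d))‖ = 0 := by
        intro z
        have := ext_smul (0 : ℂ) (0 : XSpace d α hα) (subset_closure z.2)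
        rw [smul_zero, zero_mul] at this
        rw [this, norm_zero]
      rw [norm_def, h1, norm_zero, iSup_congr h2, Real.iSup_const_zero, add_zero]

instance : NormedAddCommGroup (XSpace d α hα) := NormedAddCommGroup.ofCore normedSpaceCore

instance : NormedSpace ℂ (XSpace d α hα) := NormedSpace.ofCore normedSpaceCore

theorem norm_toBCF_le (f : XSpace d α hα) : ‖f.toBCF‖ ≤ ‖f‖ := by
  rw [norm_def]; linarith [f.iSup_norm_ext_nonneg]

theorem norm_ext_le (f : XSpace d α hα) {z : EuclideanSpace ℂ (Fin d)}
    (hz : z ∈ closure (Omega d α)) : ‖f.ext z‖ ≤ ‖f‖ := by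
  rw [norm_def]; linarith [f.norm_ext_le_iSup hz, norm_nonneg f.toBCF]

theorem ext_sub (f g : XSpace d α hα) {z : EuclideanSpace ℂ (Fin d)}
    (hz : z ∈ closure (Omega d α)) : (f - g).ext z = f.ext z - g.ext z := by
  have := ext_add (f - g) g hz
  rw [sub_add_cancel] at this
  rw [this, add_sub_cancel_right]

end XSpace

/-- A uniform limit of holomorphic functions on an open subset of a normed space is holomorphic. -/
theorem differentiableOn_of_tendstoUniformlyOn {E : Type*} [NormedAddCommGroup E]
    [NormedSpace ℂ E] {s : Set E} (hs : IsOpen s) {F : ℕ → E → ℂ} {G : E → ℂ}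
    (hF : ∀ n, DifferentiableOn ℂ (F n) s) (h : TendstoUniformlyOn F G atTop s) :
    DifferentiableOn ℂ G s := by
  intro x hx
  obtain ⟨r, hr, hrs⟩ := Metric.isOpen_iff.mp hs x hx
  have hU : UniformCauchySeqOn (fun n => fderiv ℂ (F n)) atTop (Metric.ball x (r / 2)) := by
    rw [Metric.uniformCauchySeqOn_iff]
    intro ε hε
    obtain ⟨N, hN⟩ := Metric.uniformCauchySeqOn_iff.mp h.uniformCauchySeqOn (ε * r / 16)
      (by positivity)
    refine ⟨N, fun m hm n hn y hy => ?_⟩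
    have hsub : Metric.ball y (r / 2) ⊆ s := by
      refine Subset.trans (fun w hw => ?_) hrs
      have h1 := Metric.mem_ball.mp hw
      have h2 := Metric.mem_ball.mp hy
      exact Metric.mem_ball.mpr (by linarith [dist_triangle w y x])
    have hys : y ∈ s := hsub (Metric.mem_ball_self (by positivity))
    have hsy : s ∈ 𝓝 y := hs.mem_nhds hys
    have hd : DifferentiableOn ℂ (fun w => F m w - F n w) (Metric.ball y (r / 2)) :=
      ((hF m).sub (hF n)).mono hsub
    have hmaps : MapsTo (fun w => F m w - F n w) (Metric.ball y (r / 2))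
        (Metric.closedBall (F m y - F n y) (ε * r / 8)) := by
      intro w hw
      have h1 := hN m hm n hn w (hsub hw)
      have h2 := hN m hm n hn y hys
      rw [dist_eq_norm] at h1 h2
      rw [Metric.mem_closedBall, dist_eq_norm]
      linarith [norm_sub_le (F m w - F n w) (F m y - F n y)]
    have key := Complex.norm_fderiv_le_div_of_mapsTo_ball hd hmaps (by positivity)
    have e : fderiv ℂ (fun w => F m w - F n w) y = fderiv ℂ (F m) y - fderiv ℂ (F n) y :=
      fderiv_fun_sub ((hF m).differentiableAt hsy) ((hF n).differentiableAt hsy)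
    rw [e] at key
    rw [dist_eq_norm]
    refine key.trans_lt ?_
    have : ε * r / 8 / (r / 2) = ε / 4 := by field_simp; norm_num
    rw [this]; linarith
  have hpt : ∀ y ∈ Metric.ball x (r / 2), ∃ l, Tendsto (fun n => fderiv ℂ (F n) y) atTop (𝓝 l) :=
    fun y hy => cauchySeq_tendsto_of_complete (hU.cauchySeq hy)
  choose! g' hg' using hpt
  have hlim := hU.tendstoUniformlyOn_of_tendsto hg'
  have hsub : Metric.ball x (r / 2) ⊆ s :=
    (Metric.ball_subset_ball (by linarith)).trans hrs
  exact (hasFDerivAt_of_tendstoUniformlyOn Metric.isOpen_ball hlim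
    (fun n y hy => ((hF n).differentiableAt (hs.mem_nhds (hsub hy))).hasFDerivAt)
    (fun y hy => h.tendsto_at (hsub hy))
    (Metric.mem_ball_self (by positivity))).differentiableAt.differentiableWithinAt

namespace XSpace

variable {d : ℕ} {α : ℝ} {hα : 0 < α}

instance : CompleteSpace (XSpace d α hα) := by
  refine Metric.complete_of_cauchySeq_tendsto fun u hu => ?_
  have hu' := Metric.cauchySeq_iff.mp hu
  have hdist : ∀ m n, dist (u m).toBCF (u n).toBCF ≤ dist (u m) (u n) := by
    intro m n
    rw [dist_eq_norm, dist_eq_norm]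
    exact norm_toBCF_le (u m - u n)
  have hdiste : ∀ m n, ∀ z ∈ closure (Omega d α),
      dist ((u m).ext z) ((u n).ext z) ≤ dist (u m) (u n) := by
    intro m n z hz
    rw [dist_eq_norm, dist_eq_norm, ← ext_sub _ _ hz]
    exact norm_ext_le _ hz
  have hc : CauchySeq fun n => (u n).toBCF := by
    refine Metric.cauchySeq_iff.mpr fun ε hε => ?_
    obtain ⟨N, hN⟩ := hu' ε hε
    exact ⟨N, fun m hm n hn => (hdist m n).trans_lt (hN m hm n hn)⟩
  obtain ⟨f, hf⟩ := cauchySeq_tendsto_of_complete hc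
  have hce : UniformCauchySeqOn (fun n => (u n).ext) atTop (closure (Omega d α)) := by
    refine Metric.uniformCauchySeqOn_iff.mpr fun ε hε => ?_
    obtain ⟨N, hN⟩ := hu' ε hε
    exact ⟨N, fun m hm n hn z hz => (hdiste m n z hz).trans_lt (hN m hm n hn)⟩
  have hpt : ∀ z ∈ closure (Omega d α), ∃ l, Tendsto (fun n => (u n).ext z) atTop (𝓝 l) :=
    fun z hz => cauchySeq_tendsto_of_complete (hce.cauchySeq hz)
  choose! F hF using hpt
  have hlim := hce.tendstoUniformlyOn_of_tendsto hF
  have hfu := BoundedContinuousFunction.tendsto_iff_tendstoUniformly.mp hf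
  have hext : IsHolExtension d α f F := by
    refine ⟨hlim.continuousOn (Eventually.frequently (Eventually.of_forall
      fun n => (u n).isHolExtension_ext.continuousOn)), ?_, fun x hx => ?_⟩
    · exact differentiableOn_of_tendstoUniformlyOn (isOpen_Omega d α)
        (fun n => (u n).isHolExtension_ext.holomorphic) (hlim.mono subset_closure)
    · have hxO : toComplex x ∈ Omega d α := by
        have e1 : reVec (toComplex x) = x := by ext j; simp [reVec, toComplex]
        have e2 : imVec (toComplex x) = 0 := by ext j; simp [imVec, toComplex]
        change ‖reVec (toComplex x)‖ + α * ‖imVec (toComplex x)‖ < 1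
        rw [e1, e2]; simpa using hx
      refine tendsto_nhds_unique (hF _ (subset_closure hxO)) ?_
      refine (hfu.tendsto_at x).congr fun n => ?_
      exact ((u n).isHolExtension_ext.extends_ball x hx).symm
  have hfuc : UniformContinuous f :=
    hfu.uniformContinuous (Eventually.frequently (Eventually.of_forall fun n => (u n).2.1))
  let v : XSpace d α hα := ⟨f, hfuc, F, hext⟩
  have hv : EqOn v.ext F (closure (Omega d α)) := v.ext_eqOn hext
  refine ⟨v, Metric.tendsto_atTop.mpr fun ε hε => ?_⟩
  obtain ⟨N₁, h₁⟩ := Metric.tendsto_atTop.mp hf (ε / 4) (by positivity)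
  obtain ⟨N₂, h₂⟩ := eventually_atTop.mp (Metric.tendstoUniformlyOn_iff.mp hlim (ε / 4)
    (by positivity))
  refine ⟨max N₁ N₂, fun n hn => ?_⟩
  have a₁ : ‖(u n).toBCF - f‖ < ε / 4 := by
    rw [← dist_eq_norm]; exact h₁ n ((le_max_left _ _).trans hn)
  have a₂ : (⨆ z : Omega d α, ‖(u n - v).ext (z : EuclideanSpace ℂ (Fin d))‖) ≤ ε / 4 := by
    refine Real.iSup_le (fun z => ?_) (by positivity)
    have hz := subset_closure z.2
    rw [ext_sub _ _ hz, hv hz, ← dist_eq_norm, dist_comm]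
    exact (h₂ n ((le_max_right _ _).trans hn) z hz).le
  have e : (u n - v).toBCF = (u n).toBCF - f := rfl
  rw [dist_eq_norm, norm_def, e]
  linarith

end XSpace

/-! ## Strongly continuous and analytic semigroups -/

/-- A `C₀`-semigroup of bounded operators on a Banach space. -/
structure IsC0Semigroup {X : Type*} [NormedAddCommGroup X] [NormedSpace ℂ X] [CompleteSpace X]
    (S : ℝ≥0 → X →L[ℂ] X) : Prop where
  map_zero : S 0 = ContinuousLinearMap.id ℂ X
  map_add : ∀ s t, S (s + t) = (S s).comp (S t)
  continuous_orbit : ∀ x, Continuous fun t => S t x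

/-- The open sector `{z ∈ ℂ \ {0} : |arg z| < θ}`. -/
def sector (θ : ℝ) : Set ℂ := {z | z ≠ 0 ∧ |z.arg| < θ}

/-- An analytic semigroup on a Banach space: a `C₀`-semigroup `(S t)_{t ≥ 0}` which extends, for
some angle `θ ∈ (0, π/2]`, to a family `(T z)` indexed by the sector of half-opening `θ` together
with `0`, which satisfies the semigroup law, is holomorphic in the operator norm on the sector,
and is strongly continuous at `0` in every smaller sector. -/
structure IsAnalyticSemigroup {X : Type*} [NormedAddCommGroup X] [NormedSpace ℂ X]
    [CompleteSpace X] (S : ℝ≥0 → X →L[ℂ] X) : Prop where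
  isC0Semigroup : IsC0Semigroup S
  exists_extension : ∃ θ : ℝ, 0 < θ ∧ θ ≤ Real.pi / 2 ∧ ∃ T : ℂ → X →L[ℂ] X,
    (∀ t : ℝ≥0, T ((t : ℝ) : ℂ) = S t) ∧
    (∀ z ∈ sector θ, ∀ w ∈ sector θ, T (z + w) = (T z).comp (T w)) ∧
    DifferentiableOn ℂ T (sector θ) ∧
    ∀ θ', 0 < θ' → θ' < θ → ∀ x, Tendsto (fun z => T z x) (𝓝[sector θ'] 0) (𝓝 x)

/-! ## The heat semigroup -/

/-- The heat kernel `G_d(t, x) = (4 π t)^{-d/2} exp(-|x|² / (4 t))` for `t > 0`, `x ∈ ℝ^d`. -/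
def heatKernel (d : ℕ) (t : ℝ) (x : EuclideanSpace ℝ (Fin d)) : ℝ :=
  1 / (4 * Real.pi * t) ^ ((d : ℝ) / 2) * Real.exp (-‖x‖ ^ 2 / (4 * t))

/-- The action of the heat semigroup on functions on `ℝ^d`: `𝕋_t y = G_d(t) ⋆ y` for `t > 0`,
and `𝕋_0 y = y`. -/
def heatFlow (d : ℕ) (t : ℝ) (y : EuclideanSpace ℝ (Fin d) → ℂ) (x : EuclideanSpace ℝ (Fin d)) :
    ℂ :=
  if t = 0 then y x else ∫ x₀, (heatKernel d t (x - x₀) : ℂ) * y x₀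

/-- `g = (∂_1 f, …, ∂_d f)`: the function `f` is of class `C¹` on `ℝ^d`, and each of its first
partial derivatives is (the element `g j` of) `X_α`. -/
structure IsGradient {d : ℕ} {α : ℝ} {hα : 0 < α} (f : XSpace d α hα)
    (g : Fin d → XSpace d α hα) : Prop where
  contDiff : ContDiff ℝ 1 f
  partial_eq : ∀ j x, g j x = fderiv ℝ f x (EuclideanSpace.single j 1)

end HeatHol

end

open HeatHol

/-!
The heat flow of `y ∈ X_α` at a complex time `ζ` extends to the entire function
`heatExt ζ y z = ∫ G(ζ, z - x) y(x) dx` of `z ∈ ℂ^d`, so each `𝕋_ζ y` has a holomorphic extension,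
and the only problem is to bound it on `Ω_α` uniformly in `ζ`: the modulus of the Gaussian kernel
`G(ζ, z - x)` blows up as `ζ → 0` where `|x - Re z| < |Im z|`. Near `Re z` the integration over
`ℝ^d` is therefore replaced by integration over a contour. For `z = a + i b ∈ Ω_α` choose a radius
`r` with `α |b| < r < 1 - |a|`, and replace each point `x` of the ball `B(a, r)` by
`w = x + i (1 - |x - a| / r) b`. This contour passes through `z`, stays in `Ω_α`, where `y` is
holomorphic, and agrees with `ℝ^d` on the boundary of the ball. On it
`|Im (z - w)| ≤ |Re (z - w)| / α`, as is also true of the real points outside the ball. Since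
`α > 1`, the kernel is bounded there by a real Gaussian whose mass does not depend on `ζ`, for all
`ζ` in a small cone around the positive half-line (`norm_complexHeat_le`).

That the deformation does not change the integral (`setIntegral_ball_eq_deform`) is seen by
replacing the factor `i` by a complex parameter `s`: the integral is holomorphic in `s`, and
for small real `s` it is constant by the change of variables formula.

The resulting estimate (`norm_heatExt_Omega_le`) allows data of the size `A + B |w - z|²` and
points at distance at most `√|ζ|` from `Ω_α`. This gives at once

* the bound of `𝕋_ζ` on `X_α`;
* the gradient bound, by Cauchy's estimate on balls of radius `√|ζ|` (`norm_heatGrad_le`);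
* strong continuity at `0`, on replacing `y` by `y - y(z)` and using that `y` and its extension are
  uniformly continuous (`exists_quadratic_modulus`, `tendsto_heatOp`).

The semigroup law is the convolution of Gaussians. Holomorphy in the operator norm follows from the
pointwise holomorphy and the uniform bound, because evaluations at points form a norming family
(`differentiableOn_of_norming`).
-/

open Set Filter Topology MeasureTheory
open scoped NNReal BoundedContinuousFunction

noncomputable section

namespace HeatHol

/-! ### Holomorphic dependence on parameters -/

/-- The derivative in a finite-dimensional parameter is measurable, since its components in a basis
are limits of difference quotients. -/
theorem aestronglyMeasurable_fderiv_param {P : Type*} [NormedAddCommGroup P] [NormedSpace ℂ P]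
    [FiniteDimensional ℂ P] {X : Type*} [MeasurableSpace X] {μ : Measure X} {U : Set P}
    (hU : IsOpen U) {F : P → X → ℂ} (hm : ∀ p ∈ U, AEStronglyMeasurable (F p) μ)
    (hd : ∀ᵐ x ∂μ, DifferentiableOn ℂ (fun p => F p x) U) {p : P} (hp : p ∈ U) :
    AEStronglyMeasurable (fun x => fderiv ℂ (fun q => F q x) p) μ := by
  have hdir : ∀ v : P, AEStronglyMeasurable (fun x => fderiv ℂ (fun q => F q x) p v) μ := by
    intro v
    have hc : Tendsto (fun n : ℕ => (n : ℂ)⁻¹) atTop (𝓝 0) := tendsto_inv_atTop_nhds_zero_nat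
    have hev : ∀ᶠ n : ℕ in atTop, p + (n : ℂ)⁻¹ • v ∈ U := by
      have : Tendsto (fun n : ℕ => p + (n : ℂ)⁻¹ • v) atTop (𝓝 p) := by
        simpa using (hc.smul_const v).const_add p
      exact this.eventually (hU.mem_nhds hp)
    obtain ⟨N, hN⟩ := eventually_atTop.mp hev
    refine aestronglyMeasurable_of_tendsto_ae atTop
      (f := fun (n : ℕ) x => ((n + N : ℕ) : ℂ) • (F (p + ((n + N : ℕ) : ℂ)⁻¹ • v) x - F p x))
      (fun n => ((hm _ (hN _ (Nat.le_add_left N n))).sub (hm p hp)).const_smul ((n + N : ℕ) : ℂ)) ?_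
    filter_upwards [hd] with x hx
    have h1 := ((hx p hp).differentiableAt (hU.mem_nhds hp)).hasFDerivAt
    refine h1.lim v (c := fun n : ℕ => ((n + N : ℕ) : ℂ)) (l := atTop) ?_
    simp only [Complex.norm_natCast]
    exact tendsto_natCast_atTop_atTop.comp (tendsto_add_atTop_nat N)
  let b := Module.finBasis ℂ P
  have e : (fun x => fderiv ℂ (fun q => F q x) p) = fun x => ∑ i,
      (fderiv ℂ (fun q => F q x) p (b i)) • LinearMap.toContinuousLinearMap (b.coord i) := by
    funext x
    ext v
    conv_lhs => rw [← b.sum_repr v, map_sum]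
    simp [mul_comm]
  rw [e]
  exact Finset.aestronglyMeasurable_fun_sum _ fun i _ => (hdir _).smul_const _

/-- An integral depending holomorphically on a finite-dimensional parameter, with a locally
uniform integrable bound for the integrand, is holomorphic: Cauchy's estimate turns the bound for
the integrand into a bound for its derivative. -/
theorem differentiableOn_integral_param {P : Type*} [NormedAddCommGroup P] [NormedSpace ℂ P]
    [FiniteDimensional ℂ P] {X : Type*} [MeasurableSpace X] {μ : Measure X} {U : Set P}
    (hU : IsOpen U) {F : P → X → ℂ} (hm : ∀ p ∈ U, AEStronglyMeasurable (F p) μ)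
    (hd : ∀ᵐ x ∂μ, DifferentiableOn ℂ (fun p => F p x) U)
    (hb : ∀ p ∈ U, ∃ V ∈ 𝓝 p, ∃ g : X → ℝ, Integrable g μ ∧ ∀ᵐ x ∂μ, ∀ q ∈ V, ‖F q x‖ ≤ g x) :
    DifferentiableOn ℂ (fun p => ∫ x, F p x ∂μ) U := by
  intro p hp
  obtain ⟨V, hV, g, hg, hVg⟩ := hb p hp
  obtain ⟨R, hR, hRs⟩ := Metric.mem_nhds_iff.mp (inter_mem hV (hU.mem_nhds hp))
  have hpR : p ∈ Metric.ball p R := Metric.mem_ball_self hR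
  have key : HasFDerivAt (fun p => ∫ x, F p x ∂μ) (∫ x, fderiv ℂ (fun q => F q x) p ∂μ) p := by
    refine hasFDerivAt_integral_of_dominated_of_fderiv_le (𝕜 := ℂ)
      (F' := fun q x => fderiv ℂ (fun q => F q x) q) (bound := fun x => (2 * g x) / (R / 2))
      (Metric.ball_mem_nhds p (half_pos hR)) ?_ ?_ ?_ ?_ ?_ ?_
    · filter_upwards [hU.mem_nhds hp] with q hq using hm q hq
    · refine hg.mono' (hm p hp) ?_
      filter_upwards [hVg] with x hx using hx p (hRs hpR).1
    · exact aestronglyMeasurable_fderiv_param hU hm hd hp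
    · filter_upwards [hVg, hd] with x hx hdx q hq
      have hsub : Metric.ball q (R / 2) ⊆ Metric.ball p R := by
        intro w hw
        have h1 := Metric.mem_ball.mp hw
        have h2 := Metric.mem_ball.mp hq
        exact Metric.mem_ball.mpr (by linarith [dist_triangle w q p])
      refine Complex.norm_fderiv_le_div_of_mapsTo_ball
        (hdx.mono fun w hw => (hRs (hsub hw)).2) (fun w hw => ?_) (half_pos hR)
      have h1 := hx w (hRs (hsub hw)).1
      have h2 := hx q (hRs (hsub (Metric.mem_ball_self (half_pos hR)))).1
      rw [Metric.mem_closedBall, dist_eq_norm]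
      linarith [norm_sub_le (F w x) (F q x)]
    · exact (hg.const_mul 2).div_const _
    · filter_upwards [hd] with x hx q hq
      have hqU : q ∈ U := (hRs (Metric.ball_subset_ball (by linarith) hq)).2
      exact ((hx q hqU).differentiableAt (hU.mem_nhds hqU)).hasFDerivAt
  exact key.differentiableAt.differentiableWithinAt

/-- A function with values in a Banach space is holomorphic if it is so when tested against a
norming family of functionals, with a uniform bound. The bound makes the function locally
Lipschitz, so its Cauchy integral exists; the functionals do not distinguish the two. -/
theorem differentiableOn_of_norming {E : Type*} [NormedAddCommGroup E] [NormedSpace ℂ E]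
    [CompleteSpace E] {ι : Type*} (ℓ : ι → E →L[ℂ] ℂ) {K : ℝ}
    (hℓ : ∀ (e : E) (c : ℝ), 0 ≤ c → (∀ i, ‖ℓ i e‖ ≤ c) → ‖e‖ ≤ K * c)
    {U : Set ℂ} (hU : IsOpen U) {g : ℂ → E} {M : ℝ} (hM : ∀ i, ∀ u ∈ U, ‖ℓ i (g u)‖ ≤ M)
    (hg : ∀ i, DifferentiableOn ℂ (fun u => ℓ i (g u)) U) : DifferentiableOn ℂ g U := by
  intro u₀ hu₀
  obtain ⟨R, hR, hRU⟩ := Metric.isOpen_iff.mp hU u₀ hu₀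
  have hM' : ∀ i, ∀ u ∈ U, ‖ℓ i (g u)‖ ≤ |M| := fun i u hu => (hM i u hu).trans (le_abs_self M)
  have hlip : ∀ i, ∀ u ∈ Metric.ball u₀ (R / 2), ∀ v ∈ Metric.ball u₀ (R / 2),
      ‖ℓ i (g v) - ℓ i (g u)‖ ≤ 2 * |M| / (R / 2) * ‖v - u‖ := by
    intro i u hu v hv
    refine (convex_ball u₀ (R / 2)).norm_image_sub_le_of_norm_fderiv_le (𝕜 := ℂ)
      (f := fun u => ℓ i (g u)) (fun w hw => ?_) (fun w hw => ?_) hu hv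
    · exact ((hg i).differentiableAt
        (hU.mem_nhds (hRU (Metric.ball_subset_ball (by linarith) hw))))
    · have hsub : Metric.ball w (R / 2) ⊆ U := by
        refine Subset.trans (fun x hx => ?_) hRU
        have h1 := Metric.mem_ball.mp hx
        have h2 := Metric.mem_ball.mp hw
        exact Metric.mem_ball.mpr (by linarith [dist_triangle x w u₀])
      refine Complex.norm_fderiv_le_div_of_mapsTo_ball ((hg i).mono hsub) (fun x hx => ?_)
        (half_pos hR)
      have h1 := hM' i x (hsub hx)
      have h2 := hM' i w (hsub (Metric.mem_ball_self (half_pos hR)))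
      rw [Metric.mem_closedBall, dist_eq_norm]
      linarith [norm_sub_le (ℓ i (g x)) (ℓ i (g w))]
  have hcont : ContinuousOn g (Metric.ball u₀ (R / 2)) := by
    have : LipschitzOnWith (Real.toNNReal (K * (2 * |M| / (R / 2)))) g
        (Metric.ball u₀ (R / 2)) := by
      refine LipschitzOnWith.of_dist_le' fun v hv u hu => ?_
      rw [dist_eq_norm, dist_eq_norm, mul_assoc]
      refine hℓ _ _ (by positivity) fun i => ?_
      rw [map_sub]
      exact hlip i u hu v hv
    exact this.continuousOn
  have hr : 0 < R / 4 := by positivity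
  let r : ℝ≥0 := ⟨R / 4, hr.le⟩
  have hcb : Metric.closedBall u₀ (r : ℝ) ⊆ Metric.ball u₀ (R / 2) :=
    Metric.closedBall_subset_ball (by change R / 4 < R / 2; linarith)
  have hci : CircleIntegrable g u₀ r :=
    (hcont.mono (Metric.sphere_subset_closedBall.trans hcb)).circleIntegrable r.2
  have hps := hasFPowerSeriesOn_cauchy_integral hci (show 0 < r from hr)
  have heq : EqOn g (fun w => (2 * Real.pi * Complex.I : ℂ)⁻¹ •
      ∮ z in C(u₀, (r : ℝ)), (z - w)⁻¹ • g z) (Metric.ball u₀ (r : ℝ)) := by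
    intro w hw
    rw [← sub_eq_zero, ← norm_le_zero_iff]
    refine (hℓ _ 0 le_rfl fun i => ?_).trans_eq (mul_zero K)
    have hkey := Complex.two_pi_I_inv_smul_circleIntegral_sub_inv_smul_of_differentiable_on_off_countable
      (f := fun u => ℓ i (g u)) countable_empty hw ((hg i).continuousOn.mono
        (hcb.trans ((Metric.ball_subset_ball (by linarith)).trans hRU)))
      (fun x hx => (hg i).differentiableAt (hU.mem_nhds (hRU (Metric.ball_subset_ball
        (by linarith) (hcb (Metric.ball_subset_closedBall hx.1))))))
    have hint : CircleIntegrable (fun z => (z - w)⁻¹ • g z) u₀ r := by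
      refine ContinuousOn.circleIntegrable r.2 (ContinuousOn.smul (ContinuousOn.inv₀
        (by fun_prop) fun z hz => ?_) (hcont.mono (Metric.sphere_subset_closedBall.trans hcb)))
      rintro h0
      rw [sub_eq_zero] at h0
      subst h0
      rw [Metric.mem_sphere] at hz
      rw [Metric.mem_ball] at hw
      linarith
    have hcomm : ℓ i (∮ z in C(u₀, (r : ℝ)), (z - w)⁻¹ • g z)
        = ∮ z in C(u₀, (r : ℝ)), (z - w)⁻¹ • ℓ i (g z) := by
      simp only [circleIntegral]
      rw [← ContinuousLinearMap.intervalIntegral_comp_comm _ hint.out]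
      simp
    rw [map_sub, map_smul, hcomm, hkey, sub_self, norm_zero]
  have hr' : (0 : ENNReal) < r := ENNReal.coe_pos.mpr hr
  have hd := (hps.differentiableOn u₀ (Metric.mem_eball_self hr')).differentiableAt
    (Metric.eball_mem_nhds u₀ hr')
  have hev : g =ᶠ[𝓝 u₀] (fun w => (2 * Real.pi * Complex.I : ℂ)⁻¹ •
      ∮ z in C(u₀, (r : ℝ)), (z - w)⁻¹ • g z) :=
    heq.eventuallyEq_of_mem (Metric.ball_mem_nhds u₀ hr)
  exact (hd.congr_of_eventuallyEq hev).differentiableWithinAt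

/-! ### Complex quadratic form on `ℂ^d` -/

/-- The complex bilinear form `v · w = ∑ v_j w_j` on `ℂ^d` (no conjugation). -/
def dot {d : ℕ} (v w : EuclideanSpace ℂ (Fin d)) : ℂ := ∑ j, v j * w j

theorem norm_dot_le {d : ℕ} (v w : EuclideanSpace ℂ (Fin d)) : ‖dot v w‖ ≤ ‖v‖ * ‖w‖ := by
  rw [EuclideanSpace.norm_eq, EuclideanSpace.norm_eq]
  refine (norm_sum_le _ _).trans ?_
  simp only [norm_mul]
  exact Real.sum_mul_le_sqrt_mul_sqrt _ _ _

theorem dot_add_self {d : ℕ} (v w : EuclideanSpace ℂ (Fin d)) :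
    dot (v + w) (v + w) = dot v v + 2 * dot v w + dot w w := by
  simp only [dot, PiLp.add_apply, Finset.mul_sum, ← Finset.sum_add_distrib]
  exact Finset.sum_congr rfl fun j _ => by ring

theorem re_dot_self {d : ℕ} (v : EuclideanSpace ℂ (Fin d)) :
    (dot v v).re = ‖reVec v‖ ^ 2 - ‖imVec v‖ ^ 2 := by
  simp only [dot, EuclideanSpace.norm_sq_eq, reVec, imVec, Complex.re_sum, Complex.mul_re,
    Finset.sum_sub_distrib, Real.norm_eq_abs, sq_abs]
  simp only [sq]

theorem abs_im_dot_self_le {d : ℕ} (v : EuclideanSpace ℂ (Fin d)) :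
    |(dot v v).im| ≤ 2 * (‖reVec v‖ * ‖imVec v‖) := by
  have h : (dot v v).im = 2 * inner ℝ (reVec v) (imVec v) := by
    simp only [dot, reVec, imVec, Complex.im_sum, Complex.mul_im, PiLp.inner_apply, Finset.mul_sum]
    refine Finset.sum_congr rfl fun j _ => ?_
    simp
    ring
  rw [h, abs_mul, abs_two]
  gcongr
  exact abs_real_inner_le_norm _ _

theorem dot_toComplex_self {d : ℕ} (x : EuclideanSpace ℝ (Fin d)) :
    dot (toComplex x) (toComplex x) = (‖x‖ : ℂ) ^ 2 := by
  rw [← Complex.ofReal_pow, EuclideanSpace.norm_sq_eq]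
  simp [dot, toComplex, sq]

@[simp] theorem reVec_toComplex {d : ℕ} (x : EuclideanSpace ℝ (Fin d)) :
    reVec (toComplex x) = x := by
  ext j; simp [reVec, toComplex]

@[simp] theorem imVec_toComplex {d : ℕ} (x : EuclideanSpace ℝ (Fin d)) :
    imVec (toComplex x) = 0 := by
  ext j; simp [imVec, toComplex]

theorem reVec_sub {d : ℕ} (z w : EuclideanSpace ℂ (Fin d)) :
    reVec (z - w) = reVec z - reVec w := by
  ext j; simp [reVec]

theorem imVec_sub {d : ℕ} (z w : EuclideanSpace ℂ (Fin d)) :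
    imVec (z - w) = imVec z - imVec w := by
  ext j; simp [imVec]

/-- The inclusion `ℝ^d ⊆ ℂ^d` as a real linear isometry. -/
def toComplexLI (d : ℕ) : EuclideanSpace ℝ (Fin d) →ₗᵢ[ℝ] EuclideanSpace ℂ (Fin d) where
  toFun := toComplex
  map_add' x y := by ext j; simp [toComplex]
  map_smul' c x := by ext j; simp [toComplex]
  norm_map' x := by
    simp [EuclideanSpace.norm_eq, toComplex]

theorem norm_toComplex {d : ℕ} (x : EuclideanSpace ℝ (Fin d)) : ‖toComplex x‖ = ‖x‖ :=
  (toComplexLI d).norm_map x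

theorem toComplex_sub {d : ℕ} (x y : EuclideanSpace ℝ (Fin d)) :
    toComplex (x - y) = toComplex x - toComplex y := (toComplexLI d).map_sub x y

theorem continuous_toComplex {d : ℕ} : Continuous (toComplex (d := d)) :=
  (toComplexLI d).continuous

theorem toComplex_mem_Omega {d : ℕ} {α : ℝ} {x : EuclideanSpace ℝ (Fin d)} (hx : ‖x‖ < 1) :
    toComplex x ∈ Omega d α := by
  change ‖reVec (toComplex x)‖ + α * ‖imVec (toComplex x)‖ < 1
  simpa using hx

/-! ### The complex heat kernel -/

/-- A number `κ > 0` measuring how much room `α > 1` leaves: for `|Im v| ≤ |Re v| / α` the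
form `Re (v · v)` is at least `4 κ |Re v|²`. -/
def aperture (α : ℝ) : ℝ := (1 - 1 / α ^ 2) / 4

theorem aperture_pos {α : ℝ} (hα : 1 < α) : 0 < aperture α := by
  have : 1 / α ^ 2 < 1 := by
    rw [div_lt_one (by positivity)]; nlinarith
  unfold aperture; linarith

theorem aperture_lt_one (α : ℝ) : aperture α < 1 := by
  have : 0 ≤ 1 / α ^ 2 := by positivity
  unfold aperture; linarith

/-- The cone of complex times used for the heat semigroup. It is convex, and so narrow that
`Re (v · v / ζ) ≥ κ |Re v|² / |ζ|` still holds when `|Im v| ≤ |Re v| / α`, where `κ` is the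
aperture. -/
def timeCone (α : ℝ) : Set ℂ := {ζ | |ζ.im| < aperture α * ζ.re}

theorem isOpen_timeCone (α : ℝ) : IsOpen (timeCone α) :=
  isOpen_lt Complex.continuous_im.abs (continuous_const.mul Complex.continuous_re)

theorem re_pos_of_mem_timeCone {α : ℝ} (hα : 1 < α) {ζ : ℂ} (hζ : ζ ∈ timeCone α) :
    0 < ζ.re := by
  have h : |ζ.im| < aperture α * ζ.re := hζ
  exact pos_of_mul_pos_right ((abs_nonneg _).trans_lt h) (aperture_pos hα).le

theorem norm_le_two_mul_re {α : ℝ} (hα : 1 < α) {ζ : ℂ} (hζ : ζ ∈ timeCone α) :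
    ‖ζ‖ ≤ 2 * ζ.re := by
  have h : |ζ.im| < aperture α * ζ.re := hζ
  have h1 := re_pos_of_mem_timeCone hα hζ
  have h2 := Complex.norm_le_abs_re_add_abs_im ζ
  rw [abs_of_pos h1] at h2
  nlinarith [aperture_lt_one α]

theorem add_mem_timeCone {α : ℝ} {ζ ω : ℂ} (hζ : ζ ∈ timeCone α) (hω : ω ∈ timeCone α) :
    ζ + ω ∈ timeCone α := by
  have h : |ζ.im| < aperture α * ζ.re := hζ
  have h' : |ω.im| < aperture α * ω.re := hω
  change |(ζ + ω).im| < aperture α * (ζ + ω).re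
  rw [Complex.add_im, Complex.add_re, mul_add]
  linarith [abs_add_le ζ.im ω.im]

theorem ofReal_mem_timeCone {α : ℝ} (hα : 1 < α) {t : ℝ} (ht : 0 < t) : (t : ℂ) ∈ timeCone α := by
  change |(t : ℂ).im| < aperture α * (t : ℂ).re
  simpa using mul_pos (aperture_pos hα) ht

theorem sector_subset_timeCone {α : ℝ} (hα : 1 < α) :
    sector (aperture α / 2) ⊆ timeCone α := by
  rintro ζ ⟨h0, harg⟩
  have hn : 0 < ‖ζ‖ := norm_pos_iff.mpr h0
  have h1 := aperture_pos hα
  have h2 := aperture_lt_one α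
  have hs : |Real.sin ζ.arg| < aperture α / 2 :=
    (Real.abs_sin_le_abs).trans_lt harg
  have hc : 1 / 2 ≤ Real.cos ζ.arg := by
    have := Real.one_sub_sq_div_two_le_cos (x := ζ.arg)
    have h3 : ζ.arg ^ 2 ≤ 1 := by
      rw [← sq_abs]; nlinarith [abs_nonneg ζ.arg]
    linarith
  change |ζ.im| < aperture α * ζ.re
  rw [← Complex.norm_mul_sin_arg ζ, ← Complex.norm_mul_cos_arg ζ, abs_mul, abs_norm]
  calc ‖ζ‖ * |Real.sin ζ.arg| < ‖ζ‖ * (aperture α / 2) := by gcongr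
    _ ≤ aperture α * (‖ζ‖ * Real.cos ζ.arg) := by
      nlinarith [mul_le_mul_of_nonneg_left hc (mul_pos hn h1).le]

/-- The heat kernel at complex time `ζ` and at a complex vector `v`, with the principal branch of the
power; its branch cut is irrelevant for `Re ζ > 0`. -/
def complexHeat {d : ℕ} (ζ : ℂ) (v : EuclideanSpace ℂ (Fin d)) : ℂ :=
  (4 * Real.pi * ζ) ^ (-((d / 2 : ℝ) : ℂ)) * Complex.exp (-dot v v / (4 * ζ))

theorem norm_le_two_mul_reVec {d : ℕ} {α : ℝ} (hα : 1 < α) {v : EuclideanSpace ℂ (Fin d)}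
    (hv : α * ‖imVec v‖ ≤ ‖reVec v‖) : ‖v‖ ≤ 2 * ‖reVec v‖ := by
  nlinarith [norm_le_reVec_imVec v, norm_nonneg (imVec v)]

theorem re_dot_self_div_ge {d : ℕ} {α : ℝ} (hα : 1 < α) {ζ : ℂ} (hζ : ζ ∈ timeCone α)
    {v : EuclideanSpace ℂ (Fin d)} (hv : α * ‖imVec v‖ ≤ ‖reVec v‖) :
    aperture α * (‖reVec v‖ ^ 2 / ‖ζ‖) ≤ (dot v v / ζ).re := by
  have hζ' : |ζ.im| < aperture α * ζ.re := hζ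
  have hre := re_pos_of_mem_timeCone hα hζ
  have hn : 0 < ‖ζ‖ := hre.trans_le (Complex.re_le_norm ζ)
  set ρ := ‖reVec v‖
  set β := ‖imVec v‖
  have hβ0 : 0 ≤ β := norm_nonneg _
  have hρ0 : 0 ≤ ρ := norm_nonneg _
  have hαβ : β ^ 2 ≤ ρ ^ 2 * (1 / α ^ 2) := by
    rw [mul_one_div, le_div_iff₀ (by positivity), ← mul_pow, mul_comm]
    gcongr
  have hap : 1 / α ^ 2 = 1 - 4 * aperture α := by unfold aperture; ring
  rw [hap] at hαβ
  have hβρ : β ≤ ρ := by nlinarith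
  have him : (dot v v).im * ζ.im ≥ -(2 * ρ ^ 2 * (aperture α * ζ.re)) := by
    have h1 : |(dot v v).im * ζ.im| ≤ (2 * (ρ * β)) * (aperture α * ζ.re) := by
      rw [abs_mul]
      exact mul_le_mul (abs_im_dot_self_le v) hζ'.le (abs_nonneg _) (by positivity)
    have h2 : (2 * (ρ * β)) * (aperture α * ζ.re) ≤ 2 * ρ ^ 2 * (aperture α * ζ.re) := by
      have := (mul_pos (aperture_pos hα) hre).le
      refine mul_le_mul_of_nonneg_right ?_ this
      nlinarith
    linarith [neg_abs_le ((dot v v).im * ζ.im)]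
  have e : (dot v v / ζ).re = ((dot v v).re * ζ.re + (dot v v).im * ζ.im) / ‖ζ‖ ^ 2 := by
    rw [Complex.div_re, Complex.normSq_eq_norm_sq]; ring
  rw [e, le_div_iff₀ (by positivity), re_dot_self]
  have e2 : aperture α * (ρ ^ 2 / ‖ζ‖) * ‖ζ‖ ^ 2 = aperture α * ρ ^ 2 * ‖ζ‖ := by
    field_simp
  rw [e2]
  have h3 : aperture α * ρ ^ 2 * ‖ζ‖ ≤ aperture α * ρ ^ 2 * (2 * ζ.re) :=
    mul_le_mul_of_nonneg_left (norm_le_two_mul_re hα hζ)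
      (mul_nonneg (aperture_pos hα).le (sq_nonneg ρ))
  have h4 : (4 * aperture α * ρ ^ 2) * ζ.re ≤ (ρ ^ 2 - β ^ 2) * ζ.re :=
    mul_le_mul_of_nonneg_right (by linarith) hre.le
  linarith

/-- The exponential rate in the Gaussian bound for the complex heat kernel. -/
def rate (α : ℝ) : ℝ := aperture α / 8

theorem rate_pos {α : ℝ} (hα : 1 < α) : 0 < rate α := by
  have := aperture_pos hα
  unfold rate; positivity

/-- Gaussian bound for the complex heat kernel near the vectors whose imaginary part is small
compared with the real part. -/
theorem norm_complexHeat_le {d : ℕ} {α : ℝ} (hα : 1 < α) {ζ : ℂ} (hζ : ζ ∈ timeCone α)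
    {v : EuclideanSpace ℂ (Fin d)} (hv : α * ‖imVec v‖ ≤ ‖reVec v‖)
    (δ : EuclideanSpace ℂ (Fin d)) :
    ‖complexHeat ζ (v + δ)‖ ≤ (4 * Real.pi * ‖ζ‖) ^ (-(d / 2 : ℝ)) *
      (Real.exp ((1 / rate α) * (‖δ‖ ^ 2 / ‖ζ‖)) *
        Real.exp (-rate α * (‖reVec v‖ ^ 2 / ‖ζ‖))) := by
  have hre := re_pos_of_mem_timeCone hα hζ
  have hn : 0 < ‖ζ‖ := hre.trans_le (Complex.re_le_norm ζ)
  have hκ := aperture_pos hα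
  have hκ1 := aperture_lt_one α
  rw [complexHeat, norm_mul, ← Complex.ofReal_neg, Complex.norm_cpow_real, Complex.norm_exp,
    ← Real.exp_add]
  have e1 : ‖(4 * Real.pi * ζ : ℂ)‖ = 4 * Real.pi * ‖ζ‖ := by
    simp [abs_of_pos Real.pi_pos]
  rw [e1]
  refine mul_le_mul_of_nonneg_left (Real.exp_le_exp.mpr ?_) (by positivity)
  have e2 : -dot (v + δ) (v + δ) / (4 * ζ) = (-1 / 4 : ℝ) * (dot v v / ζ)
      + ((-1 / 4 : ℝ) * ((2 * dot v δ + dot δ δ) / ζ)) := by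
    have : ζ ≠ 0 := by rintro rfl; simp at hre
    rw [dot_add_self]
    push_cast
    field_simp
    ring
  rw [e2, Complex.add_re, Complex.re_ofReal_mul, Complex.re_ofReal_mul]
  have h1 := re_dot_self_div_ge hα hζ hv
  have h2 : -((2 * (2 * ‖reVec v‖ * ‖δ‖) + ‖δ‖ ^ 2) / ‖ζ‖) ≤
      ((2 * dot v δ + dot δ δ) / ζ).re := by
    refine le_trans (neg_le_neg ?_) (neg_le_of_abs_le (Complex.abs_re_le_norm _))
    rw [norm_div]
    gcongr
    refine (norm_add_le _ _).trans ?_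
    rw [norm_mul, Complex.norm_two, sq]
    gcongr
    · refine (norm_dot_le v δ).trans ?_
      gcongr
      exact norm_le_two_mul_reVec hα hv
    · exact norm_dot_le δ δ
  have h3 : (4 * ‖reVec v‖ * ‖δ‖ + ‖δ‖ ^ 2) / ‖ζ‖ ≤
      aperture α / 2 * (‖reVec v‖ ^ 2 / ‖ζ‖) + (4 / rate α) * (‖δ‖ ^ 2 / ‖ζ‖) := by
    rw [← mul_div_assoc, ← mul_div_assoc, ← add_div]
    refine div_le_div_of_nonneg_right ?_ hn.le
    have e3 : 4 / rate α = 32 / aperture α := by unfold rate; field_simp; norm_num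
    rw [e3]
    have h5 : 4 * ‖reVec v‖ * ‖δ‖ ≤ aperture α / 2 * ‖reVec v‖ ^ 2 + 8 / aperture α * ‖δ‖ ^ 2 := by
      have h6 : 0 ≤ (aperture α * ‖reVec v‖ - 4 * ‖δ‖) ^ 2 / (2 * aperture α) := by positivity
      have e4 : (aperture α * ‖reVec v‖ - 4 * ‖δ‖) ^ 2 / (2 * aperture α)
          = aperture α / 2 * ‖reVec v‖ ^ 2 + 8 / aperture α * ‖δ‖ ^ 2 - 4 * ‖reVec v‖ * ‖δ‖ := by
        field_simp; ring
      linarith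
    have h7 : ‖δ‖ ^ 2 ≤ 24 / aperture α * ‖δ‖ ^ 2 := by
      refine le_mul_of_one_le_left (sq_nonneg _) ?_
      rw [one_le_div hκ]; linarith
    have e5 : 32 / aperture α * ‖δ‖ ^ 2 = 8 / aperture α * ‖δ‖ ^ 2 + 24 / aperture α * ‖δ‖ ^ 2 := by
      ring
    linarith
  have e6 : 2 * (2 * ‖reVec v‖ * ‖δ‖) = 4 * ‖reVec v‖ * ‖δ‖ := by ring
  rw [e6] at h2
  have e7 : (4 / rate α) * (‖δ‖ ^ 2 / ‖ζ‖) = 4 * ((1 / rate α) * (‖δ‖ ^ 2 / ‖ζ‖)) := by ring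
  rw [e7] at h3
  have e8 : rate α * (‖reVec v‖ ^ 2 / ‖ζ‖) = aperture α * (‖reVec v‖ ^ 2 / ‖ζ‖) / 8 := by
    unfold rate; ring
  rw [neg_mul, e8]
  linarith

theorem complexHeat_ofReal {d : ℕ} {t : ℝ} (ht : 0 < t) (x : EuclideanSpace ℝ (Fin d)) :
    complexHeat (t : ℂ) (toComplex x) = (heatKernel d t x : ℂ) := by
  have h : (0 : ℝ) ≤ 4 * Real.pi * t := by positivity
  rw [complexHeat, heatKernel, dot_toComplex_self, one_div, ← Real.rpow_neg h]
  push_cast [Complex.ofReal_cpow h]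
  rfl

/-- A perturbation of the identity by a contraction is bijective: its inverse images are fixed points
of contractions. -/
theorem bijective_add_of_lipschitz {E : Type*} [NormedAddCommGroup E] [CompleteSpace E]
    {k : E → E} {K : ℝ≥0} (hK : K < 1) (hk : LipschitzWith K k) :
    Function.Bijective fun x => x + k x := by
  constructor
  · intro x y hxy
    by_contra hne
    have h0 : 0 < dist x y := dist_pos.mpr hne
    have h1 : dist x y = dist (k x) (k y) := by
      rw [dist_eq_norm, dist_eq_norm, ← norm_neg (k x - k y)]
      congr 1
      have : x + k x = y + k y := hxy
      rw [neg_sub, sub_eq_sub_iff_add_eq_add, this, add_comm]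
    have h2 := hk.dist_le_mul x y
    have h3 : (K : ℝ) < 1 := by exact_mod_cast hK
    nlinarith
  · intro y
    have hc : ContractingWith K fun x => y - k x :=
      ⟨hK, by simpa using (LipschitzWith.const y).sub hk⟩
    refine ⟨hc.fixedPoint, ?_⟩
    have h : y - k hc.fixedPoint = hc.fixedPoint := hc.fixedPoint_isFixedPt
    exact (sub_eq_iff_eq_add.mp h).symm

/-! ### Deformation of the domain of integration -/

section Deformation

variable {d : ℕ} (a b : EuclideanSpace ℝ (Fin d)) (r : ℝ)

/-- The tent function of the ball `B(a, r)`, without truncation outside of it. -/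
def tent (x : EuclideanSpace ℝ (Fin d)) : ℝ := 1 - ‖x - a‖ / r

/-- The derivative of the tent function in the direction `b`, away from `a`. -/
def tentDeriv (x : EuclideanSpace ℝ (Fin d)) : ℝ := -(inner ℝ (x - a) b / (r * ‖x - a‖))

/-- The map `x ↦ x + s φ(x) b` from `ℝ^d` to `ℂ^d`, where `φ` is the tent function. For `s = i` it
parametrizes a piece of a contour which goes through `a + i b` and has the same boundary as the
ball `B(a, r)`. -/
def deform (s : ℂ) (x : EuclideanSpace ℝ (Fin d)) : EuclideanSpace ℂ (Fin d) :=
  toComplex x + (s * tent a r x) • toComplex b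

variable {a b r}

theorem abs_tentDeriv_le (hr : 0 < r) (x : EuclideanSpace ℝ (Fin d)) :
    |tentDeriv a b r x| ≤ ‖b‖ / r := by
  rw [tentDeriv, abs_neg, abs_div, abs_of_nonneg (by positivity : 0 ≤ r * ‖x - a‖)]
  rcases (norm_nonneg (x - a)).eq_or_lt with h | h
  · rw [← h, mul_zero, div_zero]; positivity
  · rw [div_le_div_iff₀ (by positivity) hr]
    have := abs_real_inner_le_norm (x - a) b
    nlinarith

theorem tent_nonneg (hr : 0 < r) {x : EuclideanSpace ℝ (Fin d)} (hx : x ∈ Metric.closedBall a r) :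
    0 ≤ tent a r x := by
  rw [mem_closedBall_iff_norm] at hx
  rw [tent, sub_nonneg, div_le_one hr]
  exact hx

theorem hasFDerivAt_tent {x : EuclideanSpace ℝ (Fin d)} (hx : x ≠ a) :
    HasFDerivAt (tent a r) (-((r * ‖x - a‖)⁻¹ • innerSL ℝ (x - a))) x := by
  have h0 : ‖x - a‖ ≠ 0 := norm_ne_zero_iff.mpr (sub_ne_zero.mpr hx)
  have h1 : HasFDerivAt (fun x => ‖x - a‖ ^ 2) (2 • innerSL ℝ (x - a)) x := by
    have := (hasStrictFDerivAt_norm_sq (x - a)).hasFDerivAt.comp x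
      ((hasFDerivAt_id x).sub_const a)
    simpa using! this
  have h2 := h1.sqrt (by positivity)
  have h3 : (fun x => Real.sqrt (‖x - a‖ ^ 2)) = fun x => ‖x - a‖ := by
    funext x; exact Real.sqrt_sq (norm_nonneg _)
  rw [h3, Real.sqrt_sq (norm_nonneg _)] at h2
  have h4 := (h2.const_mul r⁻¹).const_sub 1
  have e : tent a r = fun x => 1 - r⁻¹ * ‖x - a‖ := by
    funext x; rw [tent]; ring
  rw [e]
  convert! h4 using 1
  ext v
  simp
  field_simp

/-- Change of variables `x ↦ x + s φ(x) b` in the ball `B(a, r)`, for small real `s`. -/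
theorem setIntegral_ball_deform_ofReal (hb : b ≠ 0) (hr : 0 < r) {s : ℝ} (hs : |s| * ‖b‖ < r)
    (f : EuclideanSpace ℝ (Fin d) → ℂ) :
    ∫ x in Metric.ball a r, f x =
      ∫ x in Metric.ball a r, (1 + s * tentDeriv a b r x : ℝ) • f (x + (s * tent a r x) • b) := by
  have : Nontrivial (EuclideanSpace ℝ (Fin d)) := ⟨⟨b, 0, hb⟩⟩
  set k : EuclideanSpace ℝ (Fin d) → EuclideanSpace ℝ (Fin d) :=
    fun x => (s * max (tent a r x) 0) • b with hkdef
  set T : EuclideanSpace ℝ (Fin d) → EuclideanSpace ℝ (Fin d) := fun x => x + k x with hT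
  have hK0 : 0 ≤ |s| * ‖b‖ / r := by positivity
  have hk : LipschitzWith (Real.toNNReal (|s| * ‖b‖ / r)) k := by
    refine LipschitzWith.of_dist_le' fun x y => ?_
    rw [dist_eq_norm, ← sub_smul, norm_smul, ← mul_sub, norm_mul, Real.norm_eq_abs,
      Real.norm_eq_abs]
    have h1 : |max (tent a r x) 0 - max (tent a r y) 0| ≤ dist x y / r := by
      refine (abs_max_sub_max_le_abs _ _ _).trans ?_
      have e : tent a r x - tent a r y = (‖y - a‖ - ‖x - a‖) / r := by
        rw [tent, tent]; ring
      rw [e, abs_div, abs_of_pos hr]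
      gcongr
      refine (abs_norm_sub_norm_le _ _).trans_eq ?_
      rw [dist_comm, dist_eq_norm]; congr 1; abel
    calc |s| * |max (tent a r x) 0 - max (tent a r y) 0| * ‖b‖
        ≤ |s| * (dist x y / r) * ‖b‖ := by gcongr
      _ = |s| * ‖b‖ / r * dist x y := by ring
  have hbij : Function.Bijective T :=
    bijective_add_of_lipschitz (by
      rw [Real.toNNReal_lt_one, div_lt_one hr]; exact hs) hk
  have hout : ∀ x, x ∉ Metric.ball a r → T x = x := by
    intro x hx
    rw [mem_ball_iff_norm, not_lt] at hx
    have : tent a r x ≤ 0 := by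
      rw [tent, sub_nonpos, one_le_div hr]; exact hx
    simp [hT, hkdef, max_eq_right this]
  have hin : ∀ x ∈ Metric.ball a r, T x = x + (s * tent a r x) • b := by
    intro x hx
    simp only [hT, hkdef, max_eq_left (tent_nonneg hr (Metric.ball_subset_closedBall hx))]
  -- `T` is a bijection of the space and fixes the complement of the ball, so it maps the ball onto
  -- itself
  have himg : T '' Metric.ball a r = Metric.ball a r := by
    ext y
    constructor
    · rintro ⟨x, hx, rfl⟩
      by_contra hy
      have h1 := hbij.1 (hout _ hy)
      rw [h1] at hy
      exact hy hx
    · intro hy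
      obtain ⟨x, rfl⟩ := hbij.2 y
      refine ⟨x, ?_, rfl⟩
      by_contra hx
      rw [hout x hx] at hy
      exact hx hy
  have himg' : T '' (Metric.ball a r \ {a}) = Metric.ball a r \ {T a} := by
    rw [image_sdiff hbij.1, himg, image_singleton]
  -- the centre, where the tent function is not differentiable, is negligible
  have hnull : ∀ c : EuclideanSpace ℝ (Fin d),
      (Metric.ball a r \ {c} : Set _) =ᵐ[volume] Metric.ball a r :=
    fun c => sdiff_null_ae_eq_self (measure_singleton c)
  let T' : EuclideanSpace ℝ (Fin d) → EuclideanSpace ℝ (Fin d) →L[ℝ] EuclideanSpace ℝ (Fin d) :=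
    fun x => ContinuousLinearMap.id ℝ _ +
      (s • (-((r * ‖x - a‖)⁻¹ • innerSL ℝ (x - a)))).smulRight b
  have hT' : ∀ x ∈ (Metric.ball a r \ {a} : Set _),
      HasFDerivWithinAt T (T' x) (Metric.ball a r \ {a}) x := by
    rintro x ⟨hx, hxa⟩
    refine HasFDerivAt.hasFDerivWithinAt ?_
    have h1 : HasFDerivAt (fun x => x + (s * tent a r x) • b) (T' x) x :=
      (hasFDerivAt_id x).add (((hasFDerivAt_tent hxa).const_mul s).smul_const b)
    refine h1.congr_of_eventuallyEq ?_
    filter_upwards [Metric.isOpen_ball.mem_nhds hx] with y hy using hin y hy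
  have hdet : ∀ x, (T' x).det = 1 + s * tentDeriv a b r x := by
    intro x
    have e : ((T' x : EuclideanSpace ℝ (Fin d) →L[ℝ] EuclideanSpace ℝ (Fin d)) :
        EuclideanSpace ℝ (Fin d) →ₗ[ℝ] EuclideanSpace ℝ (Fin d)) =
        LinearMap.transvection ((s • (-((r * ‖x - a‖)⁻¹ • innerSL ℝ (x - a))) :
          EuclideanSpace ℝ (Fin d) →L[ℝ] ℝ) : Module.Dual ℝ (EuclideanSpace ℝ (Fin d))) b := by
      ext v
      simp [T', LinearMap.transvection.apply]
    rw [ContinuousLinearMap.det, e, LinearMap.transvection.det, tentDeriv]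
    simp only [ContinuousLinearMap.coe_coe, smul_apply,
      neg_apply, innerSL_apply_apply, smul_eq_mul, inner_sub_left]
    ring
  have key := integral_image_eq_integral_abs_det_fderiv_smul volume
    (Metric.isOpen_ball.measurableSet.diff (measurableSet_singleton a)) hT' hbij.1.injOn f
  rw [himg', setIntegral_congr_set (hnull _), setIntegral_congr_set (hnull _)] at key
  rw [key]
  refine setIntegral_congr_fun Metric.isOpen_ball.measurableSet fun x hx => ?_
  have hpos : 0 ≤ 1 + s * tentDeriv a b r x := by
    have h1 : |s * tentDeriv a b r x| ≤ 1 := by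
      rw [abs_mul]
      calc |s| * |tentDeriv a b r x| ≤ |s| * (‖b‖ / r) := by
            gcongr; exact abs_tentDeriv_le hr x
        _ = |s| * ‖b‖ / r := by ring
        _ ≤ 1 := by rw [div_le_one hr]; exact hs.le
    linarith [neg_abs_le (s * tentDeriv a b r x)]
  simp only [hdet, abs_of_nonneg hpos, hin x hx]

theorem reVec_deform (s : ℂ) (x : EuclideanSpace ℝ (Fin d)) :
    reVec (deform a b r s x) = x + (s.re * tent a r x) • b := by
  ext j
  simp [deform, reVec, toComplex]

theorem imVec_deform (s : ℂ) (x : EuclideanSpace ℝ (Fin d)) :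
    imVec (deform a b r s x) = (s.im * tent a r x) • b := by
  ext j
  simp [deform, imVec, toComplex]

theorem continuous_deform :
    Continuous fun p : ℂ × EuclideanSpace ℝ (Fin d) => deform a b r p.1 p.2 := by
  have := continuous_toComplex (d := d)
  unfold deform tent
  fun_prop

theorem deform_mem_Omega {α : ℝ} (hr : 0 < r) (har : ‖a‖ + r < 1) {s : ℂ}
    (hs : ‖a‖ + (|s.re| + α * |s.im|) * ‖b‖ < 1) {x : EuclideanSpace ℝ (Fin d)}
    (hx : x ∈ Metric.closedBall a r) : deform a b r s x ∈ Omega d α := by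
  change ‖reVec _‖ + α * ‖imVec _‖ < 1
  have ht := tent_nonneg hr hx
  have ht1 : tent a r x ≤ 1 := by
    have : 0 ≤ ‖x - a‖ / r := by positivity
    rw [tent]; linarith
  rw [reVec_deform, imVec_deform, norm_smul, norm_mul, Real.norm_eq_abs, Real.norm_of_nonneg ht]
  have h1 : ‖x + (s.re * tent a r x) • b‖ ≤ ‖a‖ + r * (1 - tent a r x)
      + |s.re| * tent a r x * ‖b‖ := by
    refine (norm_add_le _ _).trans ?_
    rw [norm_smul, norm_mul, Real.norm_eq_abs, Real.norm_of_nonneg ht]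
    gcongr
    have e : r * (1 - tent a r x) = ‖x - a‖ := by rw [tent]; field_simp; ring
    rw [e]
    calc ‖x‖ = ‖a + (x - a)‖ := by congr 1; abel
      _ ≤ _ := norm_add_le _ _
  have h2 : ‖a‖ + r * (1 - tent a r x) + (|s.re| + α * |s.im|) * ‖b‖ * tent a r x < 1 := by
    rcases ht.eq_or_lt with h | h
    · rw [← h]; linarith
    · nlinarith
  calc _ ≤ (‖a‖ + r * (1 - tent a r x) + |s.re| * tent a r x * ‖b‖)
        + α * (|s.im| * tent a r x * ‖b‖) := by gcongr
    _ = ‖a‖ + r * (1 - tent a r x) + (|s.re| + α * |s.im|) * ‖b‖ * tent a r x := by ring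
    _ < 1 := h2

/-- The integral of a holomorphic function over the real ball `B(a, r)` equals the integral over
the contour through `a + i b`. The integral over the contour of parameter `s` is holomorphic in
`s`, and constant for small real `s` by the change of variables formula. -/
theorem setIntegral_ball_eq_deform {α : ℝ} (hα : 0 < α) (hb : b ≠ 0) (hr : 0 < r)
    (har : ‖a‖ + r < 1) (hab : ‖a‖ + α * ‖b‖ < 1) {f : EuclideanSpace ℂ (Fin d) → ℂ}
    (hf : DifferentiableOn ℂ f (Omega d α)) :
    ∫ x in Metric.ball a r, f (toComplex x) = ∫ x in Metric.ball a r,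
      (1 + Complex.I * tentDeriv a b r x) * f (deform a b r Complex.I x) := by
  let U : Set ℂ := {s | ‖a‖ + (|s.re| + α * |s.im|) * ‖b‖ < 1}
  have hUo : IsOpen U := by
    refine isOpen_lt ?_ continuous_const
    have := Complex.continuous_re
    have := Complex.continuous_im
    fun_prop
  have hUc : Convex ℝ U := by
    intro x hx y hy p q hp hq hpq
    have hx' : ‖a‖ + (|x.re| + α * |x.im|) * ‖b‖ < 1 := hx
    have hy' : ‖a‖ + (|y.re| + α * |y.im|) * ‖b‖ < 1 := hy
    change ‖a‖ + (|(p • x + q • y).re| + α * |(p • x + q • y).im|) * ‖b‖ < 1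
    have n1 : |(p • x + q • y).re| ≤ p * |x.re| + q * |y.re| := by
      simp only [Complex.add_re, Complex.real_smul, Complex.re_ofReal_mul]
      refine (abs_add_le _ _).trans_eq ?_
      rw [abs_mul, abs_mul, abs_of_nonneg hp, abs_of_nonneg hq]
    have n2 : |(p • x + q • y).im| ≤ p * |x.im| + q * |y.im| := by
      simp only [Complex.add_im, Complex.real_smul, Complex.im_ofReal_mul]
      refine (abs_add_le _ _).trans_eq ?_
      rw [abs_mul, abs_mul, abs_of_nonneg hp, abs_of_nonneg hq]
    have n3 : (|(p • x + q • y).re| + α * |(p • x + q • y).im|) * ‖b‖ ≤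
        (p * |x.re| + q * |y.re| + α * (p * |x.im| + q * |y.im|)) * ‖b‖ := by gcongr
    have hq' : q = 1 - p := by linarith
    subst hq'
    rcases hp.eq_or_lt with h0 | h0
    · subst h0; nlinarith
    · nlinarith [mul_lt_mul_of_pos_left hx' h0, mul_le_mul_of_nonneg_left hy'.le hq]
  have hmem : ∀ s ∈ U, ∀ x ∈ Metric.closedBall a r, deform a b r s x ∈ Omega d α :=
    fun s hs x hx => deform_mem_Omega hr har hs hx
  have hDm : Measurable fun x => (tentDeriv a b r x : ℂ) := by
    refine Complex.measurable_ofReal.comp ?_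
    unfold tentDeriv
    have h1 : Continuous fun x : EuclideanSpace ℝ (Fin d) => inner ℝ (x - a) b := by fun_prop
    have h2 : Continuous fun x : EuclideanSpace ℝ (Fin d) => r * ‖x - a‖ := by fun_prop
    exact (h1.measurable.div h2.measurable).neg
  have hd : DifferentiableOn ℂ (fun s : ℂ => ∫ x in Metric.ball a r,
      (1 + s * tentDeriv a b r x) * f (deform a b r s x)) U := by
    refine differentiableOn_integral_param hUo (fun s hs => ?_) ?_ (fun s hs => ?_)
    · refine ((measurable_const.add (hDm.const_mul s)).aestronglyMeasurable).mul ?_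
      refine ContinuousOn.aestronglyMeasurable ?_ Metric.isOpen_ball.measurableSet
      refine hf.continuousOn.comp ?_ fun x hx => hmem s hs x (Metric.ball_subset_closedBall hx)
      exact (continuous_deform.comp (by fun_prop : Continuous fun x => (s, x))).continuousOn
    · filter_upwards [ae_restrict_mem Metric.isOpen_ball.measurableSet] with x hx
      refine DifferentiableOn.mul (by fun_prop) (hf.comp ?_ fun s hs =>
        hmem s hs x (Metric.ball_subset_closedBall hx))
      unfold deform
      fun_prop
    · obtain ⟨ε, hε, hεU⟩ := Metric.nhds_basis_closedBall.mem_iff.mp (hUo.mem_nhds hs)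
      have hcomp : IsCompact ((fun p : ℂ × EuclideanSpace ℝ (Fin d) => deform a b r p.1 p.2) ''
          (Metric.closedBall s ε ×ˢ Metric.closedBall a r)) :=
        ((isCompact_closedBall s ε).prod (isCompact_closedBall a r)).image continuous_deform
      obtain ⟨M, hM⟩ := hcomp.exists_bound_of_continuousOn (f := f) (hf.continuousOn.mono (by
        rintro _ ⟨p, hp, rfl⟩
        exact hmem p.1 (hεU hp.1) p.2 hp.2))
      refine ⟨Metric.closedBall s ε, Metric.closedBall_mem_nhds s hε,
        fun _ => (1 + (‖s‖ + ε) * (‖b‖ / r)) * M, ?_, ?_⟩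
      · have : IsFiniteMeasure (volume.restrict (Metric.ball a r)) :=
          isFiniteMeasure_restrict.mpr measure_ball_lt_top.ne
        exact integrable_const _
      · filter_upwards [ae_restrict_mem Metric.isOpen_ball.measurableSet] with x hx q hq
        rw [norm_mul]
        have h1 : ‖f (deform a b r q x)‖ ≤ M :=
          hM _ ⟨(q, x), ⟨hq, Metric.ball_subset_closedBall hx⟩, rfl⟩
        have h2 : ‖q‖ ≤ ‖s‖ + ε := by
          have := mem_closedBall_iff_norm.mp hq
          calc ‖q‖ = ‖s + (q - s)‖ := by congr 1; abel
            _ ≤ ‖s‖ + ‖q - s‖ := norm_add_le _ _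
            _ ≤ _ := by linarith
        have h3 : ‖1 + q * tentDeriv a b r x‖ ≤ 1 + (‖s‖ + ε) * (‖b‖ / r) := by
          refine (norm_add_le _ _).trans ?_
          rw [norm_one, norm_mul, Complex.norm_real, Real.norm_eq_abs]
          gcongr
          exact abs_tentDeriv_le hr x
        exact mul_le_mul h3 h1 (norm_nonneg _) (by positivity)
  have h0U : (0 : ℂ) ∈ U := by
    change ‖a‖ + (|(0 : ℂ).re| + α * |(0 : ℂ).im|) * ‖b‖ < 1
    have : 0 ≤ α * ‖b‖ := by positivity
    simp
    linarith
  have hIU : Complex.I ∈ U := by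
    change ‖a‖ + (|Complex.I.re| + α * |Complex.I.im|) * ‖b‖ < 1
    simpa using hab
  have hfreq : ∃ᶠ s in 𝓝[≠] (0 : ℂ), (∫ x in Metric.ball a r,
      (1 + s * tentDeriv a b r x) * f (deform a b r s x)) =
      ∫ x in Metric.ball a r, f (toComplex x) := by
    have hev : ∀ᶠ s : ℝ in 𝓝[≠] 0, (∫ x in Metric.ball a r,
        (1 + (s : ℂ) * tentDeriv a b r x) * f (deform a b r s x)) =
        ∫ x in Metric.ball a r, f (toComplex x) := by
      have : ∀ᶠ s : ℝ in 𝓝 0, |s| * ‖b‖ < r := by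
        have hc : Continuous fun s : ℝ => |s| * ‖b‖ := by fun_prop
        exact hc.continuousAt.eventually_lt continuousAt_const (by simpa using hr)
      filter_upwards [this.filter_mono nhdsWithin_le_nhds] with s hs
      rw [setIntegral_ball_deform_ofReal hb hr hs fun x => f (toComplex x)]
      refine integral_congr_ae (ae_of_all _ fun x => ?_)
      have e : deform a b r s x = toComplex (x + (s * tent a r x) • b) := by
        ext j; simp [deform, toComplex]
      simp only [e, Complex.real_smul]
      push_cast
      rfl
    have ht : Tendsto (fun s : ℝ => (s : ℂ)) (𝓝[≠] 0) (𝓝[≠] 0) := by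
      refine tendsto_nhdsWithin_iff.mpr ⟨?_, ?_⟩
      · exact (Complex.continuous_ofReal.tendsto' 0 0 (by simp)).mono_left nhdsWithin_le_nhds
      · filter_upwards [self_mem_nhdsWithin] with s hs
        simpa using hs
    exact ht.frequently hev.frequently
  exact ((hd.analyticOnNhd hUo).eqOn_of_preconnected_of_frequently_eq analyticOnNhd_const
    hUc.isPreconnected h0U hfreq hIU).symm

/-- The integral over the real ball is bounded by a majorant of the function on the contour. The
factor `2` bounds the modulus of the Jacobian `1 + i ∂_b φ`. -/
theorem norm_setIntegral_ball_le_deform {α : ℝ} (hα : 0 < α) (hr : 0 < r) (hbr : ‖b‖ ≤ r)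
    (har : ‖a‖ + r < 1) (hab : ‖a‖ + α * ‖b‖ < 1) {f : EuclideanSpace ℂ (Fin d) → ℂ}
    (hf : DifferentiableOn ℂ f (Omega d α)) {g : EuclideanSpace ℝ (Fin d) → ℝ}
    (hg : IntegrableOn g (Metric.ball a r))
    (hfg : ∀ x ∈ Metric.ball a r, ‖f (deform a b r Complex.I x)‖ ≤ g x) :
    ‖∫ x in Metric.ball a r, f (toComplex x)‖ ≤ ∫ x in Metric.ball a r, 2 * g x := by
  have hg2 : IntegrableOn (fun x => 2 * g x) (Metric.ball a r) := hg.const_mul 2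
  by_cases hb : b = 0
  · subst hb
    refine norm_integral_le_of_norm_le hg2 ?_
    filter_upwards [ae_restrict_mem Metric.isOpen_ball.measurableSet] with x hx
    have h1 := hfg x hx
    have e : deform a 0 r Complex.I x = toComplex x := by
      ext j; simp [deform, toComplex]
    rw [e] at h1
    linarith [norm_nonneg (f (toComplex x))]
  · rw [setIntegral_ball_eq_deform hα hb hr har hab hf]
    refine norm_integral_le_of_norm_le hg2 ?_
    filter_upwards [ae_restrict_mem Metric.isOpen_ball.measurableSet] with x hx
    rw [norm_mul]
    refine mul_le_mul ?_ (hfg x hx) (norm_nonneg _) zero_le_two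
    refine (norm_add_le _ _).trans ?_
    rw [norm_one, norm_mul, Complex.norm_I, one_mul, Complex.norm_real, Real.norm_eq_abs]
    have := (abs_tentDeriv_le (a := a) (b := b) hr x).trans ((div_le_one hr).mpr hbr)
    linarith

end Deformation

/-! ### The heat flow at complex times and complex points -/

section HeatExt

variable {d : ℕ} {α : ℝ}

/-- The heat flow at the complex time `ζ`, evaluated at the complex vector `z`. -/
def heatExt (ζ : ℂ) (y : EuclideanSpace ℝ (Fin d) → ℂ) (z : EuclideanSpace ℂ (Fin d)) : ℂ :=
  ∫ x, complexHeat ζ (z - toComplex x) * y x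

theorem differentiable_dot_self :
    Differentiable ℂ fun v : EuclideanSpace ℂ (Fin d) => dot v v := by
  unfold dot
  fun_prop

theorem differentiableOn_complexHeat (hα : 1 < α) :
    DifferentiableOn ℂ (fun p : ℂ × EuclideanSpace ℂ (Fin d) => complexHeat p.1 p.2)
      (timeCone α ×ˢ univ) := by
  rintro ⟨ζ, v⟩ ⟨hζ, -⟩
  have hre := re_pos_of_mem_timeCone hα hζ
  have h0 : ζ ≠ 0 := by rintro rfl; simp at hre
  refine DifferentiableAt.differentiableWithinAt ?_
  unfold complexHeat
  have h1 : DifferentiableAt ℂ (fun p : ℂ × EuclideanSpace ℂ (Fin d) => 4 * Real.pi * p.1)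
      (ζ, v) := by fun_prop
  have h2 : DifferentiableAt ℂ (fun p : ℂ × EuclideanSpace ℂ (Fin d) => 4 * p.1) (ζ, v) := by
    fun_prop
  have h3 : DifferentiableAt ℂ (fun p : ℂ × EuclideanSpace ℂ (Fin d) => dot p.2 p.2) (ζ, v) :=
    (differentiable_dot_self (d := d)).differentiableAt.comp (ζ, v) differentiableAt_snd
  have h4 : (4 * Real.pi * ζ : ℂ) ∈ Complex.slitPlane := by
    refine Or.inl ?_
    have : 0 < 4 * Real.pi * ζ.re := by positivity
    simpa using this
  have h40 : (4 * ζ : ℂ) ≠ 0 := mul_ne_zero (by norm_num) h0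
  have h5 := h3.fun_neg.fun_mul (h2.fun_inv h40)
  simp only [div_eq_mul_inv]
  exact (h1.cpow (differentiableAt_const _) h4).mul h5.cexp

theorem differentiable_complexHeat (hα : 1 < α) {ζ : ℂ} (hζ : ζ ∈ timeCone α) :
    Differentiable ℂ fun v : EuclideanSpace ℂ (Fin d) => complexHeat ζ v := by
  rw [← differentiableOn_univ]
  exact (differentiableOn_complexHeat hα).comp (by fun_prop : DifferentiableOn ℂ
    (fun v : EuclideanSpace ℂ (Fin d) => (ζ, v)) univ) fun v _ => ⟨hζ, mem_univ v⟩

theorem integrable_gaussian {c : ℝ} (hc : 0 < c) :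
    Integrable fun x : EuclideanSpace ℝ (Fin d) => Real.exp (-c * ‖x‖ ^ 2) := by
  have h := (GaussianFourier.integrable_cexp_neg_mul_sq_norm_add
    (V := EuclideanSpace ℝ (Fin d)) (b := (c : ℂ)) (by simpa using hc) 0 0).norm
  refine h.congr (ae_of_all _ fun x => ?_)
  simp only [Complex.norm_exp]
  congr 1
  rw [inner_zero_left, Complex.ofReal_zero, mul_zero, add_zero, ← Complex.ofReal_neg,
    ← Complex.ofReal_pow, ← Complex.ofReal_mul, Complex.ofReal_re]

theorem norm_complexHeat_sub_le (hα : 1 < α) {ζ : ℂ} (hζ : ζ ∈ timeCone α)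
    (z : EuclideanSpace ℂ (Fin d)) (x : EuclideanSpace ℝ (Fin d)) :
    ‖complexHeat ζ (z - toComplex x)‖ ≤ (4 * Real.pi * ‖ζ‖) ^ (-(d / 2 : ℝ)) *
      (Real.exp ((1 / rate α) * (‖z‖ ^ 2 / ‖ζ‖)) * Real.exp (-rate α * (‖x‖ ^ 2 / ‖ζ‖))) := by
  have e : z - toComplex x = toComplex (-x) + z := by
    ext j; simp [toComplex]; ring
  have h := norm_complexHeat_le hα hζ (v := toComplex (-x)) (by simp) z
  rw [reVec_toComplex, norm_neg] at h
  rw [e]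
  exact h

theorem integrable_complexHeat_mul (hα : 1 < α) {ζ : ℂ} (hζ : ζ ∈ timeCone α)
    (y : EuclideanSpace ℝ (Fin d) →ᵇ ℂ) (z : EuclideanSpace ℂ (Fin d)) :
    Integrable fun x => complexHeat ζ (z - toComplex x) * y x := by
  have hn : 0 < ‖ζ‖ := (re_pos_of_mem_timeCone hα hζ).trans_le (Complex.re_le_norm ζ)
  have hr := rate_pos hα
  have hg := ((integrable_gaussian (d := d) (c := rate α / ‖ζ‖) (by positivity)).const_mul
    ((4 * Real.pi * ‖ζ‖) ^ (-(d / 2 : ℝ)) * Real.exp ((1 / rate α) * (‖z‖ ^ 2 / ‖ζ‖)))).mul_const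
      ‖y‖
  refine hg.mono' (Continuous.aestronglyMeasurable ?_) (ae_of_all _ fun x => ?_)
  · exact ((differentiable_complexHeat hα hζ).continuous.comp
      (continuous_const.sub continuous_toComplex)).mul y.continuous
  · rw [norm_mul]
    refine mul_le_mul ((norm_complexHeat_sub_le hα hζ z x).trans_eq ?_) (y.norm_coe_le_norm x)
      (norm_nonneg _) (by positivity)
    rw [mul_assoc _ (Real.exp _) (Real.exp _)]
    congr 3
    ring

/-- The heat flow of a bounded function is jointly holomorphic in the complex time and the complex
point. -/
theorem differentiableOn_heatExt (hα : 1 < α) (y : EuclideanSpace ℝ (Fin d) →ᵇ ℂ) :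
    DifferentiableOn ℂ (fun p : ℂ × EuclideanSpace ℂ (Fin d) => heatExt p.1 y p.2)
      (timeCone α ×ˢ univ) := by
  have hr := rate_pos hα
  refine differentiableOn_integral_param ((isOpen_timeCone α).prod isOpen_univ)
    (fun p hp => (integrable_complexHeat_mul hα hp.1 y p.2).aestronglyMeasurable)
    (ae_of_all _ fun x => ?_) (fun p hp => ?_)
  · have h1 : DifferentiableOn ℂ (fun p : ℂ × EuclideanSpace ℂ (Fin d) =>
        (p.1, p.2 - toComplex x)) (timeCone α ×ˢ univ) := by fun_prop
    exact ((differentiableOn_complexHeat (d := d) hα).comp h1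
      fun p hp => ⟨hp.1, mem_univ _⟩).mul (differentiableOn_const _)
  · obtain ⟨ζ₀, z₀⟩ := p
    have hn : 0 < ‖ζ₀‖ := (re_pos_of_mem_timeCone hα hp.1).trans_le (Complex.re_le_norm ζ₀)
    refine ⟨{p | p.1 ∈ timeCone α ∧ ‖ζ₀‖ / 2 < ‖p.1‖ ∧ ‖p.1‖ < 2 * ‖ζ₀‖ ∧ ‖p.2‖ < ‖z₀‖ + 1}, ?_,
      fun x => (2 * Real.pi * ‖ζ₀‖) ^ (-(d / 2 : ℝ)) *
        Real.exp ((1 / rate α) * ((‖z₀‖ + 1) ^ 2 / (‖ζ₀‖ / 2))) *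
        Real.exp (-(rate α / (2 * ‖ζ₀‖)) * ‖x‖ ^ 2) * ‖y‖, ?_, ae_of_all _ fun x p hq => ?_⟩
    · refine IsOpen.mem_nhds ?_ ⟨hp.1, by linarith, by linarith, by linarith⟩
      exact ((isOpen_timeCone α).preimage continuous_fst).inter
        ((isOpen_lt continuous_const continuous_fst.norm).inter
        ((isOpen_lt continuous_fst.norm continuous_const).inter
        (isOpen_lt continuous_snd.norm continuous_const)))
    · exact ((integrable_gaussian (by positivity)).const_mul _).mul_const _
    · obtain ⟨h1, h2, h3, h4⟩ := hq
      have hn' : 0 < ‖p.1‖ := by linarith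
      rw [norm_mul]
      refine mul_le_mul ((norm_complexHeat_sub_le hα h1 p.2 x).trans ?_) (y.norm_coe_le_norm x)
        (norm_nonneg _) (by positivity)
      rw [← mul_assoc]
      refine mul_le_mul (mul_le_mul ?_ ?_ (Real.exp_nonneg _) (by positivity)) ?_
        (Real.exp_nonneg _) (by positivity)
      · refine Real.rpow_le_rpow_of_nonpos (by positivity) ?_ (neg_nonpos.mpr (by positivity))
        nlinarith [Real.pi_pos]
      · gcongr
      · refine Real.exp_le_exp.mpr ?_
        rw [neg_mul, neg_mul, neg_le_neg_iff, div_mul_eq_mul_div, mul_div_assoc]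
        gcongr

theorem differentiable_heatExt (hα : 1 < α) {ζ : ℂ} (hζ : ζ ∈ timeCone α)
    (y : EuclideanSpace ℝ (Fin d) →ᵇ ℂ) : Differentiable ℂ (heatExt ζ y) := by
  have h1 : DifferentiableOn ℂ (fun v : EuclideanSpace ℂ (Fin d) => (ζ, v)) univ := by fun_prop
  have h2 := (differentiableOn_heatExt hα y).comp h1 fun v _ => ⟨hζ, mem_univ v⟩
  exact differentiableOn_univ.mp h2

theorem differentiableOn_heatExt_time (hα : 1 < α) (y : EuclideanSpace ℝ (Fin d) →ᵇ ℂ)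
    (z : EuclideanSpace ℂ (Fin d)) :
    DifferentiableOn ℂ (fun ζ => heatExt ζ y z) (timeCone α) := by
  have h1 : DifferentiableOn ℂ (fun ζ : ℂ => (ζ, z)) (timeCone α) := by fun_prop
  have h2 : MapsTo (fun ζ : ℂ => (ζ, z)) (timeCone α) (timeCone α ×ˢ univ) :=
    fun ζ hζ => ⟨hζ, mem_univ z⟩
  have h3 := (differentiableOn_heatExt hα y).comp h1 h2
  exact h3

/-! ### The estimate on `Ω_α` -/

/-- The Gaussian which dominates the heat kernel at time `ζ` along the contours; its mass does not
depend on `ζ`. -/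
def gaussBound (α : ℝ) (ζ : ℂ) (x : EuclideanSpace ℝ (Fin d)) : ℝ :=
  Real.exp (1 / rate α) * (8 / rate α) * (4 * Real.pi * ‖ζ‖) ^ (-(d / 2 : ℝ)) *
    Real.exp (-(rate α / (2 * ‖ζ‖)) * ‖x‖ ^ 2)

/-- The integral of `gaussBound`. -/
def gaussMass (d : ℕ) (α : ℝ) : ℝ :=
  Real.exp (1 / rate α) * (8 / rate α) * (1 / (2 * rate α)) ^ (d / 2 : ℝ)

theorem gaussMass_pos (hα : 1 < α) : 0 < gaussMass d α := by
  have := rate_pos hα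
  unfold gaussMass
  positivity

theorem gaussBound_nonneg (hα : 1 < α) (ζ : ℂ) (x : EuclideanSpace ℝ (Fin d)) :
    0 ≤ gaussBound α ζ x := by
  have := rate_pos hα
  unfold gaussBound
  positivity

theorem integrable_gaussBound_sub (hα : 1 < α) {ζ : ℂ} (hζ : ζ ≠ 0)
    (a : EuclideanSpace ℝ (Fin d)) : Integrable fun x => gaussBound α ζ (a - x) := by
  have := rate_pos hα
  have hn : 0 < ‖ζ‖ := norm_pos_iff.mpr hζ
  exact ((integrable_gaussian (d := d) (c := rate α / (2 * ‖ζ‖)) (by positivity)).const_mul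
    _).comp_sub_left a

theorem integral_gaussBound_sub (hα : 1 < α) {ζ : ℂ} (hζ : ζ ≠ 0)
    (a : EuclideanSpace ℝ (Fin d)) : ∫ x, gaussBound α ζ (a - x) = gaussMass d α := by
  have := rate_pos hα
  have hn : 0 < ‖ζ‖ := norm_pos_iff.mpr hζ
  have hpi := Real.pi_pos
  rw [integral_sub_left_eq_self (gaussBound α ζ) volume a]
  unfold gaussBound gaussMass
  rw [integral_const_mul, GaussianFourier.integral_rexp_neg_mul_sq_norm (by positivity),
    finrank_euclideanSpace_fin, mul_assoc, Real.rpow_neg (by positivity), ← Real.inv_rpow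
    (by positivity), ← Real.mul_rpow (by positivity) (by positivity)]
  congr 2
  field_simp
  norm_num

/-- The kernel times a factor of quadratic growth is dominated by `gaussBound`, at the cost of a part
of the exponential decay. -/
theorem norm_complexHeat_mul_le_gaussBound (hα : 1 < α) {ζ : ℂ} (hζ : ζ ∈ timeCone α)
    {v δ : EuclideanSpace ℂ (Fin d)} (hv : α * ‖imVec v‖ ≤ ‖reVec v‖) (hδ : ‖δ‖ ^ 2 ≤ ‖ζ‖)
    {A B p : ℝ} (hA : 0 ≤ A) (hB : 0 ≤ B) (hp0 : 0 ≤ p) (hp : p ≤ A + B * ‖v‖ ^ 2) :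
    ‖complexHeat ζ (v + δ)‖ * p ≤ (A + B * ‖ζ‖) * gaussBound α ζ (reVec v) := by
  have hn : 0 < ‖ζ‖ := (re_pos_of_mem_timeCone hα hζ).trans_le (Complex.re_le_norm ζ)
  have hr := rate_pos hα
  have hr8 : 1 ≤ 8 / rate α := by
    rw [one_le_div hr]
    have := aperture_lt_one α
    unfold rate; linarith
  set s := ‖reVec v‖ ^ 2 / ‖ζ‖ with hs
  have hs0 : 0 ≤ s := by positivity
  have h1 := norm_complexHeat_le hα hζ hv δ
  have h2 : p ≤ A + 4 * B * ‖ζ‖ * s := by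
    have e : A + 4 * B * ‖ζ‖ * s = A + B * (2 * ‖reVec v‖) ^ 2 := by
      rw [hs]; field_simp; ring
    rw [e]
    refine hp.trans ?_
    gcongr
    exact norm_le_two_mul_reVec hα hv
  have h3 : Real.exp ((1 / rate α) * (‖δ‖ ^ 2 / ‖ζ‖)) ≤ Real.exp (1 / rate α) := by
    refine Real.exp_le_exp.mpr (mul_le_of_le_one_right (by positivity) ?_)
    rw [div_le_one hn]; exact hδ
  -- a factor `exp (rate * s / 2)` of the Gaussian absorbs the growth of `p`
  have h4 : A + 4 * B * ‖ζ‖ * s ≤ (8 / rate α) * (A + B * ‖ζ‖) * Real.exp (rate α / 2 * s) := by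
    have h5 : s ≤ (2 / rate α) * Real.exp (rate α / 2 * s) := by
      have := Real.add_one_le_exp (rate α / 2 * s)
      calc s = (2 / rate α) * (rate α / 2 * s) := by field_simp
        _ ≤ _ := by gcongr; linarith
    have h6 : 1 ≤ Real.exp (rate α / 2 * s) := Real.one_le_exp (by positivity)
    calc A + 4 * B * ‖ζ‖ * s
        ≤ (8 / rate α) * A * Real.exp (rate α / 2 * s)
          + 4 * B * ‖ζ‖ * ((2 / rate α) * Real.exp (rate α / 2 * s)) := by
          refine add_le_add ?_ (by gcongr)
          rw [mul_comm (8 / rate α) A, mul_assoc]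
          exact le_mul_of_one_le_right hA (one_le_mul_of_one_le_of_one_le hr8 h6)
      _ = _ := by ring
  have e : -(rate α / (2 * ‖ζ‖)) * ‖reVec v‖ ^ 2 = -rate α * s + rate α / 2 * s := by
    rw [hs]; field_simp; ring
  calc ‖complexHeat ζ (v + δ)‖ * p
      ≤ ((4 * Real.pi * ‖ζ‖) ^ (-(d / 2 : ℝ)) * (Real.exp (1 / rate α) *
          Real.exp (-rate α * s))) *
          ((8 / rate α) * (A + B * ‖ζ‖) * Real.exp (rate α / 2 * s)) := by
        refine mul_le_mul (h1.trans ?_) (h2.trans h4) hp0 (by positivity)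
        gcongr
    _ = (A + B * ‖ζ‖) * gaussBound α ζ (reVec v) := by
        rw [gaussBound, e, Real.exp_add]
        ring

/-- The estimate at real points, where no deformation is needed. -/
theorem norm_heatExt_real_le (hα : 1 < α) {ζ : ℂ} (hζ : ζ ∈ timeCone α)
    {y : EuclideanSpace ℝ (Fin d) → ℂ} {a : EuclideanSpace ℝ (Fin d)}
    {δ : EuclideanSpace ℂ (Fin d)} (hδ : ‖δ‖ ^ 2 ≤ ‖ζ‖) {A B : ℝ} (hA : 0 ≤ A) (hB : 0 ≤ B)
    (hy : ∀ x, ‖y x‖ ≤ A + B * ‖x - a‖ ^ 2) :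
    ‖heatExt ζ y (toComplex a + δ)‖ ≤ 2 * gaussMass d α * (A + B * ‖ζ‖) := by
  have hre := re_pos_of_mem_timeCone hα hζ
  have h0 : ζ ≠ 0 := by rintro rfl; simp at hre
  have hpos : 0 ≤ gaussMass d α * (A + B * ‖ζ‖) := by
    have := gaussMass_pos (d := d) hα
    positivity
  refine (norm_integral_le_of_norm_le
    ((integrable_gaussBound_sub hα h0 a).const_mul (A + B * ‖ζ‖))
    (ae_of_all _ fun x => ?_)).trans ?_
  · have e : toComplex a + δ - toComplex x = toComplex (a - x) + δ := by
      rw [toComplex_sub]; abel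
    rw [norm_mul, e]
    have := norm_complexHeat_mul_le_gaussBound hα hζ (v := toComplex (a - x)) (by simp) hδ hA hB
      (norm_nonneg (y x)) (by rw [norm_toComplex, norm_sub_rev]; exact hy x)
    rwa [reVec_toComplex] at this
  · rw [integral_const_mul, integral_gaussBound_sub hα h0 a]
    linarith

/-- The main estimate: the size of the heat flow near a point `z` of `Ω_α` is controlled by the
growth of the data away from `z`. The ball in which the real domain of integration is deformed is
chosen so that the contour runs through `z` and stays in `Ω_α`, while the vectors from the contour
to `z` have an imaginary part which is small compared with the real part. -/
theorem norm_heatExt_Omega_le (hα : 1 < α) {ζ : ℂ} (hζ : ζ ∈ timeCone α)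
    (y : EuclideanSpace ℝ (Fin d) →ᵇ ℂ) {F : EuclideanSpace ℂ (Fin d) → ℂ}
    (hF : IsHolExtension d α y F) {z δ : EuclideanSpace ℂ (Fin d)} (hz : z ∈ Omega d α)
    (hδ : ‖δ‖ ^ 2 ≤ ‖ζ‖) {A B : ℝ} (hA : 0 ≤ A) (hB : 0 ≤ B)
    (hy : ∀ x, ‖y x‖ ≤ A + B * ‖toComplex x - z‖ ^ 2)
    (hFz : ∀ w ∈ Omega d α, ‖F w‖ ≤ A + B * ‖w - z‖ ^ 2) :
    ‖heatExt ζ y (z + δ)‖ ≤ 2 * gaussMass d α * (A + B * ‖ζ‖) := by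
  have hre := re_pos_of_mem_timeCone hα hζ
  have h0 : ζ ≠ 0 := by rintro rfl; simp at hre
  have hz' : ‖reVec z‖ + α * ‖imVec z‖ < 1 := hz
  set a := reVec z with ha
  set b := imVec z with hb
  have hα0 : 0 < α := zero_lt_one.trans hα
  obtain ⟨r, hr1, hr2⟩ := exists_between (show α * ‖b‖ < 1 - ‖a‖ by linarith)
  have hr : 0 < r := lt_of_le_of_lt (by positivity) hr1
  have hbr : ‖b‖ ≤ r := by nlinarith [norm_nonneg b]
  have hball : ∀ x ∈ Metric.ball a r, ‖x‖ < 1 := by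
    intro x hx
    have h1 := mem_ball_iff_norm.mp hx
    calc ‖x‖ = ‖a + (x - a)‖ := by congr 1; abel
      _ ≤ ‖a‖ + ‖x - a‖ := norm_add_le _ _
      _ < 1 := by linarith
  set g : EuclideanSpace ℝ (Fin d) → ℝ := fun x => (A + B * ‖ζ‖) * gaussBound α ζ (a - x) with hg
  have hgi : Integrable g := (integrable_gaussBound_sub hα h0 a).const_mul _
  have hg0 : ∀ x, 0 ≤ g x := fun x => mul_nonneg (by positivity) (gaussBound_nonneg hα ζ _)
  have hint := integrable_complexHeat_mul hα hζ y (z + δ)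
  have hsplit := integral_add_compl (μ := volume) (Metric.isOpen_ball (x := a) (ε := r)).measurableSet
    hint
  have hin : ‖∫ x in Metric.ball a r, complexHeat ζ (z + δ - toComplex x) * y x‖
      ≤ ∫ x in Metric.ball a r, 2 * g x := by
    have e : ∫ x in Metric.ball a r, complexHeat ζ (z + δ - toComplex x) * y x
        = ∫ x in Metric.ball a r, (fun w => complexHeat ζ (z + δ - w) * F w) (toComplex x) := by
      refine setIntegral_congr_fun Metric.isOpen_ball.measurableSet fun x hx => ?_
      simp only
      rw [hF.extends_ball x (by simpa using hball x hx)]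
    rw [e]
    refine norm_setIntegral_ball_le_deform hα0 hr hbr (by linarith) hz'
      (((differentiable_complexHeat hα hζ).comp (by fun_prop)).differentiableOn.mul
        hF.holomorphic) hgi.integrableOn fun x hx => ?_
    have hxc := Metric.ball_subset_closedBall hx
    set w := deform a b r Complex.I x with hw
    have hwΩ : w ∈ Omega d α := deform_mem_Omega hr (by linarith) (by simpa using hz') hxc
    have hwre : reVec (z - w) = a - x := by
      rw [reVec_sub, hw, reVec_deform]; simp [ha]
    have hwim : imVec (z - w) = (‖x - a‖ / r) • b := by
      rw [imVec_sub, hw, imVec_deform, ← hb, tent]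
      simp [sub_smul]
    have hcone : α * ‖imVec (z - w)‖ ≤ ‖reVec (z - w)‖ := by
      rw [hwre, hwim, norm_smul, norm_div, norm_norm, Real.norm_of_nonneg hr.le, norm_sub_rev a x]
      calc α * (‖x - a‖ / r * ‖b‖) = ‖x - a‖ * ((α * ‖b‖) / r) := by ring
        _ ≤ ‖x - a‖ * 1 := by
          gcongr
          rw [div_le_one hr]; exact hr1.le
        _ = _ := mul_one _
    have e2 : z + δ - w = (z - w) + δ := by abel
    change ‖complexHeat ζ (z + δ - w) * F w‖ ≤ (A + B * ‖ζ‖) * gaussBound α ζ (a - x)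
    rw [norm_mul, e2]
    have := norm_complexHeat_mul_le_gaussBound hα hζ hcone hδ hA hB (norm_nonneg (F w))
      (by rw [norm_sub_rev]; exact hFz w hwΩ)
    rwa [hwre] at this
  have hout : ‖∫ x in (Metric.ball a r)ᶜ, complexHeat ζ (z + δ - toComplex x) * y x‖
      ≤ ∫ x in (Metric.ball a r)ᶜ, 2 * g x := by
    refine norm_integral_le_of_norm_le (hgi.const_mul 2).integrableOn ?_
    filter_upwards [ae_restrict_mem Metric.isOpen_ball.measurableSet.compl] with x hx
    have hxr : r ≤ ‖x - a‖ := by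
      rw [mem_compl_iff, mem_ball_iff_norm, not_lt] at hx
      exact hx
    have hwre : reVec (z - toComplex x) = a - x := by rw [reVec_sub]; simp [ha]
    have hwim : imVec (z - toComplex x) = b := by rw [imVec_sub]; simp [hb]
    have hcone : α * ‖imVec (z - toComplex x)‖ ≤ ‖reVec (z - toComplex x)‖ := by
      rw [hwre, hwim, norm_sub_rev]; linarith
    have e2 : z + δ - toComplex x = (z - toComplex x) + δ := by abel
    rw [norm_mul, e2]
    have := norm_complexHeat_mul_le_gaussBound hα hζ hcone hδ hA hB (norm_nonneg (y x))
      (by rw [norm_sub_rev]; exact hy x)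
    rw [hwre] at this
    linarith [hg0 x]
  rw [heatExt, ← hsplit]
  refine (norm_add_le _ _).trans ((add_le_add hin hout).trans_eq ?_)
  rw [integral_add_compl Metric.isOpen_ball.measurableSet (hgi.const_mul 2), integral_const_mul,
    hg, integral_const_mul, integral_gaussBound_sub hα h0 a]
  ring

end HeatExt

/-! ### The semigroup law and the mass of the kernel -/

theorem mul_cpow_of_re_pos {a b : ℂ} (ha : 0 < a.re) (hb : 0 < b.re) (s : ℂ) :
    (a * b) ^ s = a ^ s * b ^ s := by
  have ha0 : a ≠ 0 := by rintro rfl; simp at ha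
  have hb0 : b ≠ 0 := by rintro rfl; simp at hb
  have h1 := abs_lt.mp (Complex.abs_arg_lt_pi_div_two_iff.mpr (Or.inl ha))
  have h2 := abs_lt.mp (Complex.abs_arg_lt_pi_div_two_iff.mpr (Or.inl hb))
  rw [Complex.cpow_def_of_ne_zero (mul_ne_zero ha0 hb0), Complex.cpow_def_of_ne_zero ha0,
    Complex.cpow_def_of_ne_zero hb0, ← Complex.exp_add, ← add_mul,
    Complex.log_mul ha0 hb0 ⟨by linarith, by linarith⟩]

theorem inv_re_pos {ζ : ℂ} (hζ : 0 < ζ.re) : 0 < ζ⁻¹.re := by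
  have h0 : ζ ≠ 0 := by rintro rfl; simp at hζ
  rw [Complex.inv_re]
  exact div_pos hζ (Complex.normSq_pos.mpr h0)

theorem four_pi_mul_re_pos {ζ : ℂ} (hζ : 0 < ζ.re) : 0 < (4 * Real.pi * ζ : ℂ).re := by
  have : 0 < 4 * Real.pi * ζ.re := by positivity
  simpa using this

theorem complexHeat_toComplex {d : ℕ} (ζ : ℂ) (x : EuclideanSpace ℝ (Fin d)) :
    complexHeat ζ (toComplex x) =
      ((4 * Real.pi * ζ) ^ (d / 2 : ℂ))⁻¹ * Complex.exp (-(‖x‖ : ℂ) ^ 2 / (4 * ζ)) := by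
  rw [complexHeat, dot_toComplex_self, Complex.cpow_neg]
  push_cast
  rfl

theorem integral_complexHeat_toComplex {d : ℕ} {ζ : ℂ} (hζ : 0 < ζ.re) :
    ∫ x : EuclideanSpace ℝ (Fin d), complexHeat ζ (toComplex x) = 1 := by
  have h0 : ζ ≠ 0 := by rintro rfl; simp at hζ
  have hb : 0 < ((4 * ζ)⁻¹ : ℂ).re := inv_re_pos (by simpa using hζ)
  have h := GaussianFourier.integral_cexp_neg_mul_sq_norm (V := EuclideanSpace ℝ (Fin d)) hb
  have e : ∀ x : EuclideanSpace ℝ (Fin d), -(‖x‖ : ℂ) ^ 2 / (4 * ζ) = -(4 * ζ)⁻¹ * ‖x‖ ^ 2 := by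
    intro x; ring
  have e2 : (Real.pi : ℂ) / (4 * ζ)⁻¹ = 4 * Real.pi * ζ := by
    rw [div_inv_eq_mul]; ring
  simp only [complexHeat_toComplex, e]
  rw [integral_const_mul, h, finrank_euclideanSpace_fin, e2, inv_mul_cancel₀]
  rw [Complex.cpow_ne_zero_iff]
  left
  intro h1
  have := four_pi_mul_re_pos hζ
  rw [h1] at this
  simp at this

/-- The convolution of two complex heat kernels. -/
theorem integral_complexHeat_mul_complexHeat {d : ℕ} {ζ ω : ℂ} (hζ : 0 < ζ.re) (hω : 0 < ω.re)
    (x v : EuclideanSpace ℝ (Fin d)) :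
    ∫ u, complexHeat ζ (toComplex (x - u)) * complexHeat ω (toComplex (u - v)) =
      complexHeat (ζ + ω) (toComplex (x - v)) := by
  have hζ0 : ζ ≠ 0 := by rintro rfl; simp at hζ
  have hω0 : ω ≠ 0 := by rintro rfl; simp at hω
  have hs : 0 < (ζ + ω).re := by rw [Complex.add_re]; linarith
  have hs0 : ζ + ω ≠ 0 := by intro h; rw [h] at hs; simp at hs
  set b : ℂ := (4 * ζ)⁻¹ + (4 * ω)⁻¹ with hbdef
  have hb : 0 < b.re := by
    have h1 : 0 < ((4 * ζ)⁻¹ : ℂ).re := inv_re_pos (by simpa using hζ)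
    have h2 : 0 < ((4 * ω)⁻¹ : ℂ).re := inv_re_pos (by simpa using hω)
    rw [hbdef, Complex.add_re]; linarith
  have hb0 : b ≠ 0 := by intro h; rw [h] at hb; simp at hb
  have hbe : b = (ζ + ω) / (4 * ζ * ω) := by
    rw [hbdef]; field_simp; ring
  set p := x - v with hp
  have hshift : ∫ u, complexHeat ζ (toComplex (x - u)) * complexHeat ω (toComplex (u - v))
      = ∫ u, complexHeat ζ (toComplex (p - u)) * complexHeat ω (toComplex u) := by
    rw [← integral_add_right_eq_self (fun u => complexHeat ζ (toComplex (x - u)) *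
      complexHeat ω (toComplex (u - v))) v]
    refine integral_congr_ae (ae_of_all _ fun u => ?_)
    simp only [add_sub_cancel_right]
    congr 3
    rw [hp]; abel
  have hexp : ∀ u : EuclideanSpace ℝ (Fin d),
      Complex.exp (-(‖p - u‖ : ℂ) ^ 2 / (4 * ζ)) * Complex.exp (-(‖u‖ : ℂ) ^ 2 / (4 * ω)) =
      Complex.exp (-(‖p‖ : ℂ) ^ 2 / (4 * ζ)) *
        Complex.exp (-b * ‖u‖ ^ 2 + (2 * ζ)⁻¹ * (inner ℝ p u : ℝ)) := by
    intro u
    rw [← Complex.exp_add, ← Complex.exp_add]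
    congr 1
    have h1 : (‖p - u‖ : ℂ) ^ 2 = ‖p‖ ^ 2 - 2 * (inner ℝ p u : ℝ) + ‖u‖ ^ 2 := by
      exact_mod_cast norm_sub_sq_real p u
    rw [h1, hbdef]
    field_simp
    ring
  have hgauss := GaussianFourier.integral_cexp_neg_mul_sq_norm_add hb ((2 * ζ)⁻¹) p
  rw [finrank_euclideanSpace_fin] at hgauss
  rw [hshift]
  have hfun : ∀ u : EuclideanSpace ℝ (Fin d),
      complexHeat ζ (toComplex (p - u)) * complexHeat ω (toComplex u) =
      (((4 * Real.pi * ζ) ^ (d / 2 : ℂ))⁻¹ * ((4 * Real.pi * ω) ^ (d / 2 : ℂ))⁻¹ *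
        Complex.exp (-(‖p‖ : ℂ) ^ 2 / (4 * ζ))) *
        Complex.exp (-b * ‖u‖ ^ 2 + (2 * ζ)⁻¹ * (inner ℝ p u : ℝ)) := by
    intro u
    rw [complexHeat_toComplex, complexHeat_toComplex, mul_assoc (_ * _) _ (Complex.exp _),
      ← hexp u]
    ring
  simp only [hfun]
  rw [integral_const_mul, hgauss, complexHeat_toComplex]
  have hP : 0 < (Real.pi / b : ℂ).re := by
    have : 0 < Real.pi * (b⁻¹).re := mul_pos Real.pi_pos (inv_re_pos hb)
    rw [div_eq_mul_inv]; simpa using this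
  have hpow : (4 * Real.pi * ζ) ^ (d / 2 : ℂ) * (4 * Real.pi * ω) ^ (d / 2 : ℂ) =
      (Real.pi / b) ^ (d / 2 : ℂ) * (4 * Real.pi * (ζ + ω)) ^ (d / 2 : ℂ) := by
    rw [← mul_cpow_of_re_pos (four_pi_mul_re_pos hζ) (four_pi_mul_re_pos hω),
      ← mul_cpow_of_re_pos hP (four_pi_mul_re_pos hs)]
    congr 1
    rw [hbe]
    field_simp
  have hne : ∀ z : ℂ, 0 < z.re → z ^ (d / 2 : ℂ) ≠ 0 := by
    intro z hz
    rw [Complex.cpow_ne_zero_iff]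
    left
    rintro rfl
    simp at hz
  have hexp2 : Complex.exp (-(‖p‖ : ℂ) ^ 2 / (4 * ζ)) *
      Complex.exp (((2 * ζ)⁻¹) ^ 2 * ‖p‖ ^ 2 / (4 * b)) =
      Complex.exp (-(‖p‖ : ℂ) ^ 2 / (4 * (ζ + ω))) := by
    rw [← Complex.exp_add]
    congr 1
    rw [hbe]
    field_simp
    ring
  rw [← hexp2, ← mul_inv, hpow]
  have h1 := hne _ hP
  have h2 := hne _ (four_pi_mul_re_pos hs)
  field_simp

section

variable {d : ℕ} {α : ℝ}

theorem integrable_complexHeat_real (hα : 1 < α) {ζ : ℂ} (hζ : ζ ∈ timeCone α) :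
    Integrable fun x : EuclideanSpace ℝ (Fin d) => complexHeat ζ (toComplex x) := by
  have h := (integrable_complexHeat_mul hα hζ
    (BoundedContinuousFunction.const (EuclideanSpace ℝ (Fin d)) 1) 0).comp_neg
  refine h.congr (ae_of_all _ fun x => ?_)
  have e : (0 : EuclideanSpace ℂ (Fin d)) - toComplex (-x) = toComplex x := by
    ext j; simp [toComplex]
  simp [e]

theorem heatExt_toComplex (ζ : ℂ) (y : EuclideanSpace ℝ (Fin d) → ℂ)
    (x : EuclideanSpace ℝ (Fin d)) :
    heatExt ζ y (toComplex x) = ∫ u, complexHeat ζ (toComplex (x - u)) * y u := by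
  simp only [heatExt, toComplex_sub]

/-- The semigroup law for the heat flow of functions on `ℝ^d`, by Fubini's theorem. -/
theorem heatExt_heatExt (hα : 1 < α) {ζ ω : ℂ} (hζ : ζ ∈ timeCone α) (hω : ω ∈ timeCone α)
    (y : EuclideanSpace ℝ (Fin d) →ᵇ ℂ) (x : EuclideanSpace ℝ (Fin d)) :
    heatExt ζ (fun u => heatExt ω y (toComplex u)) (toComplex x) =
      heatExt (ζ + ω) y (toComplex x) := by
  have hre := re_pos_of_mem_timeCone hα hζ
  have hre' := re_pos_of_mem_timeCone hα hω
  simp only [heatExt_toComplex, ← integral_const_mul]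
  have h1 : Integrable fun u : EuclideanSpace ℝ (Fin d) => complexHeat ζ (toComplex (x - u)) :=
    (integrable_complexHeat_real hα hζ).comp_sub_left x
  have h2 : Integrable fun u : EuclideanSpace ℝ (Fin d) => complexHeat ω (toComplex (-u)) :=
    (integrable_complexHeat_real hα hω).comp_neg
  have h3 := h1.convolution_integrand (ContinuousLinearMap.mul ℂ ℂ) h2
  have h4 : Integrable (fun p : EuclideanSpace ℝ (Fin d) × EuclideanSpace ℝ (Fin d) =>
      complexHeat ζ (toComplex (x - p.2)) * (complexHeat ω (toComplex (p.2 - p.1)) * y p.1))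
      (volume.prod volume) := by
    have h5 := h3.mul_bdd (g := fun p => y p.1) (c := ‖y‖)
      (y.continuous.comp continuous_fst).aestronglyMeasurable
      (ae_of_all _ fun p => y.norm_coe_le_norm p.1)
    refine h5.congr (ae_of_all _ fun p => ?_)
    simp only [ContinuousLinearMap.mul_apply', neg_sub]
    ring
  rw [integral_integral_swap (f := fun u v => complexHeat ζ (toComplex (x - u)) *
    (complexHeat ω (toComplex (u - v)) * y v)) h4.swap]
  refine integral_congr_ae (ae_of_all _ fun v => ?_)
  simp only [← mul_assoc]
  rw [integral_mul_const, integral_complexHeat_mul_complexHeat hre hre']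

theorem heatExt_one_toComplex (hα : 1 < α) {ζ : ℂ} (hζ : ζ ∈ timeCone α)
    (x : EuclideanSpace ℝ (Fin d)) : heatExt ζ (fun _ => 1) (toComplex x) = 1 := by
  rw [heatExt_toComplex]
  simp only [mul_one]
  rw [integral_sub_left_eq_self (fun u : EuclideanSpace ℝ (Fin d) =>
    complexHeat ζ (toComplex u)) volume x]
  exact integral_complexHeat_toComplex (re_pos_of_mem_timeCone hα hζ)

/-- The complex heat kernel has mass one even when it is centred at a point of `Ω_α`: the mass is
an entire function of the centre. -/
theorem heatExt_one (hα : 1 < α) {ζ : ℂ} (hζ : ζ ∈ timeCone α) {z : EuclideanSpace ℂ (Fin d)}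
    (hz : z ∈ Omega d α) : heatExt ζ (fun _ => 1) z = 1 := by
  have hd := differentiable_heatExt hα hζ
    (BoundedContinuousFunction.const (EuclideanSpace ℝ (Fin d)) (1 : ℂ))
  have h1 : IsHolExtension d α (fun _ => 1) (heatExt ζ fun _ => 1) :=
    ⟨hd.continuous.continuousOn, hd.differentiableOn, fun x _ => heatExt_one_toComplex hα hζ x⟩
  have h2 : IsHolExtension d α (fun _ => 1) (fun _ => 1) :=
    ⟨continuousOn_const, differentiableOn_const _, fun _ _ => rfl⟩
  exact h1.eqOn_Omega (zero_lt_one.trans hα) h2 hz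

theorem heatExt_sub_const (hα : 1 < α) {ζ : ℂ} (hζ : ζ ∈ timeCone α)
    (y : EuclideanSpace ℝ (Fin d) →ᵇ ℂ) (c : ℂ) {z : EuclideanSpace ℂ (Fin d)}
    (hz : heatExt ζ (fun _ : EuclideanSpace ℝ (Fin d) => 1) z = 1) :
    heatExt ζ (fun x => y x - c) z = heatExt ζ y z - c := by
  have h1 := integrable_complexHeat_mul hα hζ y z
  have h2 : Integrable fun x => complexHeat ζ (z - toComplex x) * 1 :=
    integrable_complexHeat_mul hα hζ
      (BoundedContinuousFunction.const (EuclideanSpace ℝ (Fin d)) (1 : ℂ)) z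
  have h3 : heatExt ζ (fun x => y x - c) z =
      heatExt ζ y z - (∫ x, complexHeat ζ (z - toComplex x) * 1) * c := by
    unfold heatExt
    rw [← integral_mul_const, ← integral_sub h1 (h2.mul_const c)]
    refine integral_congr_ae (ae_of_all _ fun x => ?_)
    simp only
    ring
  unfold heatExt at hz
  rw [h3, hz, one_mul]

end

/-! ### Derivatives of entire functions -/

section Entire

variable {P : Type*} [NormedAddCommGroup P] [NormedSpace ℂ P]

/-- Cauchy's estimate for the derivative. -/
theorem norm_fderiv_le_of_forall_norm_le {F : P → ℂ} (hF : Differentiable ℂ F) {p : P} {M ρ : ℝ}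
    (hρ : 0 < ρ) (hM : ∀ δ, ‖δ‖ ≤ ρ → ‖F (p + δ)‖ ≤ M) : ‖fderiv ℂ F p‖ ≤ 2 * M / ρ := by
  refine Complex.norm_fderiv_le_div_of_mapsTo_ball hF.differentiableOn (fun x hx => ?_) hρ
  have h1 := hM (x - p) (mem_ball_iff_norm.mp hx).le
  have h2 := hM 0 (by simpa using hρ.le)
  rw [add_sub_cancel] at h1
  rw [add_zero] at h2
  rw [mem_closedBall_iff_norm]
  linarith [norm_sub_le (F x) (F p)]

/-- The directional derivatives of an entire function of finitely many variables are entire, since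
Cauchy's formula represents them as integrals which depend holomorphically on the point. -/
theorem differentiable_fderiv_apply [FiniteDimensional ℂ P] {F : P → ℂ} (hF : Differentiable ℂ F)
    (v : P) : Differentiable ℂ fun p => fderiv ℂ F p v := by
  have hline : ∀ p : P, Differentiable ℂ fun s : ℂ => F (p + s • v) := by
    intro p
    exact hF.comp (by fun_prop)
  have hcauchy : ∀ p : P, fderiv ℂ F p v = (2 * Real.pi * Complex.I : ℂ)⁻¹ *
      ∫ θ in Ioc 0 (2 * Real.pi), deriv (circleMap 0 1) θ *
        (1 / (circleMap 0 1 θ - 0) ^ 2 * F (p + circleMap 0 1 θ • v)) := by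
    intro p
    have h1 : deriv (fun s : ℂ => F (p + s • v)) 0 = fderiv ℂ F p v := by
      have h2 : HasFDerivAt F (fderiv ℂ F p) (p + (0 : ℂ) • v) := by
        simpa using (hF p).hasFDerivAt
      have h3 : HasDerivAt (fun s : ℂ => p + s • v) v 0 := by
        simpa using ((hasDerivAt_id (0 : ℂ)).smul_const v).const_add p
      exact (h2.comp_hasDerivAt 0 h3).deriv
    have h4 := (hline p).differentiableOn.deriv_eq_smul_circleIntegral (c := 0) zero_lt_one
    rw [h1, circleIntegral, intervalIntegral.integral_of_le Real.two_pi_pos.le] at h4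
    simp only [smul_eq_mul] at h4
    rw [h4, inv_mul_cancel_left₀ Complex.two_pi_I_ne_zero]
  have hcircle : Continuous (circleMap 0 1) := continuous_circleMap 0 1
  have hderiv : Continuous (deriv (circleMap 0 1)) := by
    have : deriv (circleMap 0 1) = fun θ => circleMap 0 1 θ * Complex.I := by
      funext θ; rw [deriv_circleMap]
    rw [this]
    exact hcircle.mul continuous_const
  have hne : ∀ θ, (circleMap 0 1 θ - 0) ^ 2 ≠ 0 := by
    intro θ
    rw [sub_zero]
    exact pow_ne_zero 2 (circleMap_ne_center one_ne_zero)
  simp only [hcauchy]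
  refine Differentiable.const_mul ?_ _
  rw [← differentiableOn_univ]
  refine differentiableOn_integral_param isOpen_univ (fun p _ => ?_) (ae_of_all _ fun θ => ?_)
    fun p _ => ?_
  · refine Continuous.aestronglyMeasurable (hderiv.mul (Continuous.mul ?_ ?_))
    · exact continuous_const.div ((hcircle.sub continuous_const).pow 2) hne
    · exact hF.continuous.comp (continuous_const.add (hcircle.smul continuous_const))
  · have : Differentiable ℂ fun p => F (p + circleMap 0 1 θ • v) :=
      hF.comp (differentiable_id.add_const _)
    exact ((this.const_mul _).const_mul _).differentiableOn
  · have : ProperSpace P := FiniteDimensional.proper ℂ P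
    obtain ⟨M, hM⟩ := (isCompact_closedBall p (1 + ‖v‖)).exists_bound_of_continuousOn
      hF.continuous.continuousOn
    refine ⟨Metric.ball p 1, Metric.ball_mem_nhds p one_pos, fun _ => M, integrable_const _,
      ae_of_all _ fun θ q hq => ?_⟩
    have hmem : q + circleMap 0 1 θ • v ∈ Metric.closedBall p (1 + ‖v‖) := by
      rw [mem_closedBall_iff_norm]
      have h1 := mem_ball_iff_norm.mp hq
      calc ‖q + circleMap 0 1 θ • v - p‖ = ‖(q - p) + circleMap 0 1 θ • v‖ := by congr 1; abel
        _ ≤ ‖q - p‖ + ‖circleMap 0 1 θ • v‖ := norm_add_le _ _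
        _ ≤ 1 + ‖v‖ := by
          rw [norm_smul, norm_circleMap_zero, abs_one, one_mul]
          linarith
    have := hM _ hmem
    simpa [norm_mul] using this

end Entire

/-! ### Elements of `X_α` given by entire functions -/

/-- A function on `ℂ^d` is bounded on some neighbourhood `{|Im z| ≤ ρ}` of `ℝ^d`. -/
def TubeBounded {d : ℕ} (F : EuclideanSpace ℂ (Fin d) → ℂ) : Prop :=
  ∃ M ρ : ℝ, 0 < ρ ∧ ∀ x δ, ‖δ‖ ≤ ρ → ‖F (toComplex x + δ)‖ ≤ M

/-- By Cauchy's estimate, derivatives of a function bounded on a tube are bounded on a smaller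
tube. -/
theorem TubeBounded.fderiv_apply {d : ℕ} {F : EuclideanSpace ℂ (Fin d) → ℂ} (h : TubeBounded F)
    (hF : Differentiable ℂ F) (v : EuclideanSpace ℂ (Fin d)) :
    TubeBounded fun z => fderiv ℂ F z v := by
  obtain ⟨M, ρ, hρ, hM⟩ := h
  refine ⟨2 * M / (ρ / 2) * ‖v‖, ρ / 2, half_pos hρ, fun x δ hδ => ?_⟩
  refine (ContinuousLinearMap.le_opNorm _ _).trans ?_
  gcongr
  refine norm_fderiv_le_of_forall_norm_le hF (half_pos hρ) fun δ' hδ' => ?_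
  rw [add_assoc]
  exact hM x _ ((norm_add_le _ _).trans (by linarith))

theorem hasFDerivAt_comp_toComplex {d : ℕ} {F : EuclideanSpace ℂ (Fin d) → ℂ}
    (hF : Differentiable ℂ F) (x : EuclideanSpace ℝ (Fin d)) :
    HasFDerivAt (fun x => F (toComplex x)) (((fderiv ℂ F (toComplex x)).restrictScalars ℝ).comp
      (toComplexLI d).toContinuousLinearMap) x :=
  ((hF (toComplex x)).hasFDerivAt.restrictScalars ℝ).comp x
    (toComplexLI d).toContinuousLinearMap.hasFDerivAt

/-- By Cauchy's estimate, a function bounded on a tube is Lipschitz along `ℝ^d`. -/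
theorem TubeBounded.uniformContinuous {d : ℕ} {F : EuclideanSpace ℂ (Fin d) → ℂ}
    (h : TubeBounded F) (hF : Differentiable ℂ F) :
    UniformContinuous fun x => F (toComplex x) := by
  obtain ⟨M, ρ, hρ, hM⟩ := h
  have hlip : LipschitzWith (Real.toNNReal (2 * M / ρ)) fun x => F (toComplex x) := by
    refine LipschitzWith.of_dist_le' fun x y => ?_
    rw [dist_eq_norm, dist_eq_norm]
    refine convex_univ.norm_image_sub_le_of_norm_hasFDerivWithin_le
      (fun w _ => (hasFDerivAt_comp_toComplex hF w).hasFDerivWithinAt) (fun w _ => ?_)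
      (mem_univ y) (mem_univ x)
    have h1 := norm_fderiv_le_of_forall_norm_le hF hρ (hM w)
    refine ContinuousLinearMap.opNorm_le_bound _ ((norm_nonneg _).trans h1) fun v => ?_
    refine ((fderiv ℂ F (toComplex w)).le_opNorm (toComplex v)).trans ?_
    rw [norm_toComplex]
    gcongr
  exact hlip.uniformContinuous

namespace XSpace

variable {d : ℕ} {α : ℝ} {hα : 0 < α}

theorem ext_of_apply {f g : XSpace d α hα} (h : ∀ x, f x = g x) : f = g :=
  Subtype.ext (BoundedContinuousFunction.ext h)

theorem norm_apply_le (f : XSpace d α hα) (x : EuclideanSpace ℝ (Fin d)) : ‖f x‖ ≤ ‖f‖ :=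
  (f.toBCF.norm_coe_le_norm x).trans f.norm_toBCF_le

theorem norm_le_of_forall (f : XSpace d α hα) {M : ℝ} (hM : 0 ≤ M) (h : ∀ x, ‖f x‖ ≤ M)
    (h' : ∀ z ∈ Omega d α, ‖f.ext z‖ ≤ M) : ‖f‖ ≤ 2 * M := by
  rw [norm_def, two_mul]
  exact add_le_add ((BoundedContinuousFunction.norm_le hM).mpr h)
    (Real.iSup_le (fun z => h' z z.2) hM)

/-- The element of `X_α` given by the restriction of an entire function. -/
def ofEntire (hα : 0 < α) (F : EuclideanSpace ℂ (Fin d) → ℂ) (hF : Differentiable ℂ F)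
    (h : TubeBounded F) : XSpace d α hα :=
  ⟨BoundedContinuousFunction.ofNormedAddCommGroup (fun x => F (toComplex x))
    (hF.continuous.comp continuous_toComplex) h.choose fun x => by
      obtain ⟨ρ, hρ, hM⟩ := h.choose_spec
      simpa using hM x 0 (by simpa using hρ.le),
    h.uniformContinuous hF, F,
    ⟨hF.continuous.continuousOn, hF.differentiableOn, fun _ _ => rfl⟩⟩

theorem ext_ofEntire (F : EuclideanSpace ℂ (Fin d) → ℂ) (hF : Differentiable ℂ F)
    (h : TubeBounded F) {z : EuclideanSpace ℂ (Fin d)} (hz : z ∈ Omega d α) :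
    (ofEntire hα F hF h).ext z = F z :=
  ext_eqOn _ ⟨hF.continuous.continuousOn, hF.differentiableOn, fun _ _ => rfl⟩ (subset_closure hz)

/-- Evaluation at a real point, as a continuous functional on `X_α`. -/
def evalCLM (x : EuclideanSpace ℝ (Fin d)) : XSpace d α hα →L[ℂ] ℂ :=
  LinearMap.mkContinuous
    { toFun := fun f => f x
      map_add' := fun _ _ => rfl
      map_smul' := fun _ _ => rfl } 1 fun f => by
    rw [one_mul]; exact f.norm_apply_le x

/-- Evaluation of the extension at a point of `Ω_α`, as a continuous functional on `X_α`. -/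
def extCLM (z : Omega d α) : XSpace d α hα →L[ℂ] ℂ :=
  LinearMap.mkContinuous
    { toFun := fun f => f.ext z
      map_add' := fun f g => ext_add f g (subset_closure z.2)
      map_smul' := fun c f => ext_smul c f (subset_closure z.2) } 1 fun f => by
    rw [one_mul]; exact f.norm_ext_le (subset_closure z.2)

end XSpace

/-! ### Moduli of continuity -/

theorem norm_reVec_le {d : ℕ} (z : EuclideanSpace ℂ (Fin d)) : ‖reVec z‖ ≤ ‖z‖ := by
  rw [EuclideanSpace.norm_eq, EuclideanSpace.norm_eq]
  refine Real.sqrt_le_sqrt (Finset.sum_le_sum fun j _ => ?_)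
  have : ‖reVec z j‖ ≤ ‖z j‖ := Complex.abs_re_le_norm (z j)
  gcongr

theorem norm_reVec_lt_one {d : ℕ} {α : ℝ} (hα : 0 < α) {z : EuclideanSpace ℂ (Fin d)}
    (hz : z ∈ Omega d α) : ‖reVec z‖ < 1 := by
  have h : ‖reVec z‖ + α * ‖imVec z‖ < 1 := hz
  have : 0 ≤ α * ‖imVec z‖ := by positivity
  linarith

namespace XSpace

variable {d : ℕ} {α : ℝ} {hα : 0 < α}

/-- The oscillation of an element of `X_α`, both along `ℝ^d` and from a point of `Ω_α`, grows at
most quadratically up to an arbitrarily small constant. A real point outside the unit ball is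
compared with a point of `Ω_α` through the point of the unit ball on the same ray whose norm is
that of the real part. -/
theorem exists_quadratic_modulus (f : XSpace d α hα) {ε : ℝ} (hε : 0 < ε) : ∃ B : ℝ, 0 ≤ B ∧
    (∀ x a, ‖f x - f a‖ ≤ ε + B * ‖x - a‖ ^ 2) ∧
    (∀ z ∈ Omega d α, ∀ x, ‖f x - f.ext z‖ ≤ ε + B * ‖toComplex x - z‖ ^ 2) ∧
    ∀ z ∈ Omega d α, ∀ w ∈ Omega d α, ‖f.ext w - f.ext z‖ ≤ ε + B * ‖w - z‖ ^ 2 := by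
  have huc : UniformContinuous f := f.2.1
  obtain ⟨η₁, hη₁, h₁⟩ := Metric.uniformContinuous_iff.mp huc (ε / 2) (half_pos hε)
  obtain ⟨η₂, hη₂, h₂⟩ := Metric.uniformContinuousOn_iff.mp
    ((isCompact_closure_Omega d hα).uniformContinuousOn_of_continuous
      f.isHolExtension_ext.continuousOn) (ε / 2) (half_pos hε)
  set η := min η₁ (η₂ / 2) with hη
  have hη0 : 0 < η := lt_min hη₁ (half_pos hη₂)
  have hηη₁ : η ≤ η₁ := min_le_left _ _
  have hηη₂ : η ≤ η₂ / 2 := min_le_right _ _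
  set B := 2 * ‖f‖ / η ^ 2 with hB
  have hB0 : 0 ≤ B := by positivity
  -- it suffices to consider points at distance less than `η`
  have hfar : ∀ (p q : ℂ) (D : ℝ), 0 ≤ D → ‖p‖ ≤ ‖f‖ → ‖q‖ ≤ ‖f‖ → (D < η → ‖p - q‖ ≤ ε) →
      ‖p - q‖ ≤ ε + B * D ^ 2 := by
    intro p q D hD hp hq hnear
    rcases lt_or_ge D η with h | h
    · have : 0 ≤ B * D ^ 2 := by positivity
      linarith [hnear h]
    · have h3 : 2 * ‖f‖ ≤ B * D ^ 2 := by
        rw [hB, div_mul_eq_mul_div, le_div_iff₀ (by positivity)]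
        gcongr
      linarith [norm_sub_le p q]
  refine ⟨B, hB0, fun x a => ?_, fun z hz x => ?_, fun z hz w hw => ?_⟩
  · refine hfar _ _ _ (norm_nonneg _) (f.norm_apply_le x) (f.norm_apply_le a) fun h => ?_
    have := h₁ (a := x) (b := a) (by rw [dist_eq_norm]; linarith)
    rw [dist_eq_norm] at this
    linarith
  · refine hfar _ _ _ (norm_nonneg _) (f.norm_apply_le x) (f.norm_ext_le (subset_closure hz))
      fun h => ?_
    have hext : ∀ x', ‖x'‖ < 1 → ‖toComplex x' - z‖ < η₂ → ‖f x' - f.ext z‖ < ε / 2 := by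
      intro x' hx' hd
      have := h₂ (toComplex x') (subset_closure (toComplex_mem_Omega hx')) z (subset_closure hz)
        (by rw [dist_eq_norm]; exact hd)
      rwa [f.isHolExtension_ext.extends_ball x' (by simpa using hx'), dist_eq_norm] at this
    rcases lt_or_ge ‖x‖ 1 with hx | hx
    · linarith [hext x hx (by linarith)]
    · have ha := norm_reVec_lt_one hα hz
      set a := reVec z with hadef
      have hx0 : 0 < ‖x‖ := by linarith
      set x' := (‖a‖ / ‖x‖) • x with hx'
      have hnx' : ‖x'‖ = ‖a‖ := by
        rw [hx', norm_smul, norm_div, norm_norm, norm_norm, div_mul_cancel₀ _ hx0.ne']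
      have hxa : ‖x - a‖ ≤ ‖toComplex x - z‖ := by
        have := norm_reVec_le (toComplex x - z)
        rwa [reVec_sub, reVec_toComplex] at this
      have hxx' : ‖x' - x‖ ≤ ‖toComplex x - z‖ := by
        have e : x' - x = (‖a‖ / ‖x‖ - 1) • x := by rw [hx', sub_smul, one_smul]
        have hle : ‖a‖ / ‖x‖ - 1 ≤ 0 := by
          rw [sub_nonpos, div_le_one hx0]; linarith
        rw [e, norm_smul, Real.norm_of_nonpos hle, neg_sub, sub_mul, one_mul,
          div_mul_cancel₀ _ hx0.ne']
        exact (norm_sub_norm_le x a).trans hxa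
      have h3 : ‖f x' - f.ext z‖ < ε / 2 := by
        refine hext x' (by rw [hnx']; exact ha) ?_
        have e : toComplex x' - z = toComplex (x' - x) + (toComplex x - z) := by
          rw [toComplex_sub]; abel
        rw [e]
        refine (norm_add_le _ _).trans_lt ?_
        rw [norm_toComplex]
        linarith
      have h4 := h₁ (a := x) (b := x') (by rw [dist_comm, dist_eq_norm]; linarith)
      rw [dist_eq_norm] at h4
      have e : f x - f.ext z = (f x - f x') + (f x' - f.ext z) := by ring
      rw [e]
      exact (norm_add_le _ _).trans (by linarith)
  · refine hfar _ _ _ (norm_nonneg _) (f.norm_ext_le (subset_closure hw))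
      (f.norm_ext_le (subset_closure hz)) fun h => ?_
    have := h₂ w (subset_closure hw) z (subset_closure hz) (by rw [dist_eq_norm]; linarith)
    rw [dist_eq_norm] at this
    linarith

end XSpace

/-! ### The heat semigroup on `X_α` -/

section Semigroup

variable {d : ℕ} {α : ℝ} (hα : 1 < α)

theorem norm_heatExt_le {ζ : ℂ} (hζ : ζ ∈ timeCone α) (y : XSpace d α (zero_lt_one.trans hα))
    {z : EuclideanSpace ℂ (Fin d)} (hz : z ∈ range toComplex ∪ Omega d α)
    {δ : EuclideanSpace ℂ (Fin d)} (hδ : ‖δ‖ ≤ Real.sqrt ‖ζ‖) :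
    ‖heatExt ζ y (z + δ)‖ ≤ 2 * gaussMass d α * ‖y‖ := by
  have hδ' : ‖δ‖ ^ 2 ≤ ‖ζ‖ := by
    rw [← Real.sq_sqrt (norm_nonneg ζ)]
    gcongr
  have e : 2 * gaussMass d α * ‖y‖ = 2 * gaussMass d α * (‖y‖ + 0 * ‖ζ‖) := by ring
  rw [e]
  rcases hz with ⟨a, rfl⟩ | hz
  · exact norm_heatExt_real_le hα hζ hδ' (norm_nonneg y) le_rfl fun x => by
      simpa using y.norm_apply_le x
  · exact norm_heatExt_Omega_le hα hζ y.toBCF y.isHolExtension_ext hz hδ' (norm_nonneg y) le_rfl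
      (fun x => by simpa using y.norm_apply_le x)
      fun w hw => by simpa using y.norm_ext_le (subset_closure hw)

theorem tubeBounded_heatExt {ζ : ℂ} (hζ : ζ ∈ timeCone α) (y : XSpace d α (zero_lt_one.trans hα)) :
    TubeBounded (heatExt ζ y) :=
  ⟨2 * gaussMass d α * ‖y‖, Real.sqrt ‖ζ‖, Real.sqrt_pos.mpr
    ((re_pos_of_mem_timeCone hα hζ).trans_le (Complex.re_le_norm ζ)),
    fun x _ hδ => norm_heatExt_le hα hζ y (Or.inl ⟨x, rfl⟩) hδ⟩

/-- The heat flow of an element of `X_α`, as an element of `X_α`. -/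
def heatX {ζ : ℂ} (hζ : ζ ∈ timeCone α) (y : XSpace d α (zero_lt_one.trans hα)) :
    XSpace d α (zero_lt_one.trans hα) :=
  XSpace.ofEntire _ (heatExt ζ y) (differentiable_heatExt hα hζ y.toBCF)
    (tubeBounded_heatExt hα hζ y)

theorem norm_heatX_le {ζ : ℂ} (hζ : ζ ∈ timeCone α) (y : XSpace d α (zero_lt_one.trans hα)) :
    ‖heatX hα hζ y‖ ≤ 4 * gaussMass d α * ‖y‖ := by
  have hb : ∀ z ∈ range toComplex ∪ Omega d α, ‖heatExt ζ y z‖ ≤ 2 * gaussMass d α * ‖y‖ := by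
    intro z hz
    simpa using norm_heatExt_le hα hζ y hz (δ := 0) (by simp)
  have hm := gaussMass_pos (d := d) hα
  refine ((heatX hα hζ y).norm_le_of_forall (by positivity) (fun x => hb _ (Or.inl ⟨x, rfl⟩))
    fun z hz => ?_).trans_eq (by ring)
  rw [heatX, XSpace.ext_ofEntire _ _ _ hz]
  exact hb z (Or.inr hz)

open Classical in
/-- The heat semigroup on `X_α` at complex times in the cone. It is the identity at all other
times, in particular at the time `0`. -/
def heatOp (ζ : ℂ) :
    XSpace d α (zero_lt_one.trans hα) →L[ℂ] XSpace d α (zero_lt_one.trans hα) :=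
  if hζ : ζ ∈ timeCone α then
    LinearMap.mkContinuous
      { toFun := heatX hα hζ
        map_add' := fun y₁ y₂ => XSpace.ext_of_apply fun x => by
          change heatExt ζ (y₁ + y₂ : XSpace d α _) (toComplex x) =
            heatExt ζ y₁ (toComplex x) + heatExt ζ y₂ (toComplex x)
          unfold heatExt
          rw [← integral_add (integrable_complexHeat_mul hα hζ y₁.toBCF _)
            (integrable_complexHeat_mul hα hζ y₂.toBCF _)]
          exact integral_congr_ae (ae_of_all _ fun u => mul_add _ (y₁ u) (y₂ u))
        map_smul' := fun c y => XSpace.ext_of_apply fun x => by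
          change heatExt ζ (c • y : XSpace d α _) (toComplex x) = c * heatExt ζ y (toComplex x)
          unfold heatExt
          rw [← integral_const_mul]
          exact integral_congr_ae (ae_of_all _ fun u => mul_left_comm _ c (y u)) }
      (4 * gaussMass d α) (norm_heatX_le hα hζ)
  else ContinuousLinearMap.id ℂ _

theorem heatOp_of_mem {ζ : ℂ} (hζ : ζ ∈ timeCone α) (y : XSpace d α (zero_lt_one.trans hα)) :
    heatOp hα ζ y = heatX hα hζ y := by
  rw [heatOp, dif_pos hζ]
  rfl

theorem heatOp_zero : heatOp (d := d) hα 0 = ContinuousLinearMap.id ℂ _ := by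
  refine dif_neg fun h => ?_
  have := re_pos_of_mem_timeCone hα h
  simp at this

theorem heatOp_apply {ζ : ℂ} (hζ : ζ ∈ timeCone α) (y : XSpace d α (zero_lt_one.trans hα))
    (x : EuclideanSpace ℝ (Fin d)) : heatOp hα ζ y x = heatExt ζ y (toComplex x) := by
  rw [heatOp_of_mem hα hζ]
  rfl

theorem ext_heatOp {ζ : ℂ} (hζ : ζ ∈ timeCone α) (y : XSpace d α (zero_lt_one.trans hα))
    {z : EuclideanSpace ℂ (Fin d)} (hz : z ∈ Omega d α) :
    (heatOp hα ζ y).ext z = heatExt ζ y z := by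
  rw [heatOp_of_mem hα hζ, heatX, XSpace.ext_ofEntire _ _ _ hz]

theorem norm_heatOp_apply_le {ζ : ℂ} (hζ : ζ ∈ timeCone α)
    (y : XSpace d α (zero_lt_one.trans hα)) :
    ‖heatOp hα ζ y‖ ≤ 4 * gaussMass d α * ‖y‖ := by
  rw [heatOp_of_mem hα hζ]
  exact norm_heatX_le hα hζ y

theorem heatOp_add {ζ ω : ℂ} (hζ : ζ ∈ timeCone α) (hω : ω ∈ timeCone α) :
    heatOp (d := d) hα (ζ + ω) = (heatOp hα ζ).comp (heatOp hα ω) := by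
  ext1 y
  refine XSpace.ext_of_apply fun x => ?_
  rw [ContinuousLinearMap.comp_apply, heatOp_apply hα (add_mem_timeCone hζ hω),
    heatOp_apply hα hζ, heatOp_of_mem hα hω]
  exact (heatExt_heatExt hα hζ hω y.toBCF x).symm

/-- The heat semigroup is holomorphic in the operator norm: the evaluations at real points and at
points of `Ω_α`, applied to the images of the unit vectors, form a norming family. -/
theorem differentiableOn_heatOp :
    DifferentiableOn ℂ (heatOp (d := d) hα) (timeCone α) := by
  let X := XSpace d α (zero_lt_one.trans hα)
  let ℓ : {y : X // ‖y‖ ≤ 1} × (EuclideanSpace ℝ (Fin d) ⊕ Omega d α) → (X →L[ℂ] X) →L[ℂ] ℂ :=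
    fun i => (Sum.elim XSpace.evalCLM XSpace.extCLM i.2 : X →L[ℂ] ℂ).comp
      (ContinuousLinearMap.apply ℂ X i.1.1)
  refine differentiableOn_of_norming ℓ (K := 2) (M := 4 * gaussMass d α) (fun T c hc h => ?_)
    (isOpen_timeCone α) ?_ ?_
  · refine T.opNorm_le_of_unit_norm (by positivity) fun y hy => ?_
    exact (T y).norm_le_of_forall hc (fun x => h (⟨y, hy.le⟩, Sum.inl x))
      fun z hz => h (⟨y, hy.le⟩, Sum.inr ⟨z, hz⟩)
  · rintro ⟨⟨y, hy⟩, x | z⟩ ζ hζ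
    all_goals
      have hm := gaussMass_pos (d := d) hα
      have h1 := norm_heatOp_apply_le hα hζ y
      have h2 : 4 * gaussMass d α * ‖y‖ ≤ 4 * gaussMass d α :=
        mul_le_of_le_one_right (by positivity) hy
    · exact ((heatOp hα ζ y).norm_apply_le x).trans (h1.trans h2)
    · exact ((heatOp hα ζ y).norm_ext_le (subset_closure z.2)).trans (h1.trans h2)
  · rintro ⟨⟨y, hy⟩, x | z⟩
    · exact (differentiableOn_heatExt_time hα y.toBCF (toComplex x)).congr
        fun ζ hζ => heatOp_apply hα hζ y x
    · exact (differentiableOn_heatExt_time hα y.toBCF z).congr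
        fun ζ hζ => ext_heatOp hα hζ y z.2

/-- Strong continuity at the time `0`: the main estimate is applied to `y - y(z)`. -/
theorem tendsto_heatOp (y : XSpace d α (zero_lt_one.trans hα)) :
    Tendsto (fun ζ => heatOp hα ζ y) (𝓝[timeCone α] 0) (𝓝 y) := by
  have hm := gaussMass_pos (d := d) hα
  refine Metric.tendsto_nhds.mpr fun ε hε => ?_
  set e := ε / (8 * gaussMass d α) with he
  have he0 : 0 < e := by positivity
  obtain ⟨B, hB, h1, h2, h3⟩ := y.exists_quadratic_modulus he0
  have hsmall : ∀ᶠ ζ : ℂ in 𝓝 0, e + B * ‖ζ‖ < 2 * e := by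
    have hc : Continuous fun ζ : ℂ => e + B * ‖ζ‖ := by fun_prop
    exact hc.continuousAt.eventually_lt continuousAt_const (by simp; linarith)
  filter_upwards [hsmall.filter_mono nhdsWithin_le_nhds, self_mem_nhdsWithin] with ζ hζs hζ
  have hzero : ‖(0 : EuclideanSpace ℂ (Fin d))‖ ^ 2 ≤ ‖ζ‖ := by simp
  have hreal : ∀ a, ‖heatExt ζ y (toComplex a) - y a‖ ≤ 2 * gaussMass d α * (e + B * ‖ζ‖) := by
    intro a
    have h4 := norm_heatExt_real_le hα hζ (y := fun x => y x - y a) hzero he0.le hB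
      fun x => h1 x a
    rwa [add_zero, heatExt_sub_const hα hζ y.toBCF (y a) (heatExt_one_toComplex hα hζ a)] at h4
  have hcomplex : ∀ z ∈ Omega d α,
      ‖heatExt ζ y z - y.ext z‖ ≤ 2 * gaussMass d α * (e + B * ‖ζ‖) := by
    intro z hz
    have hF : IsHolExtension d α
        (y.toBCF - BoundedContinuousFunction.const (EuclideanSpace ℝ (Fin d)) (y.ext z) :
          EuclideanSpace ℝ (Fin d) →ᵇ ℂ) (fun w => y.ext w - y.ext z) :=
      ⟨y.isHolExtension_ext.continuousOn.sub continuousOn_const,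
        y.isHolExtension_ext.holomorphic.sub (differentiableOn_const _), fun x hx => by
          rw [y.isHolExtension_ext.extends_ball x hx]; rfl⟩
    have h4 := norm_heatExt_Omega_le hα hζ _ hF hz hzero he0.le hB (h2 z hz) (h3 z hz)
    rw [add_zero] at h4
    have h5 := heatExt_sub_const hα hζ y.toBCF (y.ext z) (heatExt_one hα hζ hz)
    rw [← h5]
    exact h4
  rw [dist_eq_norm]
  refine ((heatOp hα ζ y - y).norm_le_of_forall (by positivity)
    (fun a => ?_) fun z hz => ?_).trans_lt
      (show 2 * (2 * gaussMass d α * (e + B * ‖ζ‖)) < ε from ?_)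
  · have h6 : (heatOp hα ζ y - y) a = heatExt ζ y (toComplex a) - y a := by
      rw [← heatOp_apply hα hζ]; rfl
    rw [h6]
    exact hreal a
  · rw [XSpace.ext_sub _ _ (subset_closure hz), ext_heatOp hα hζ y hz]
    exact hcomplex z hz
  · calc 2 * (2 * gaussMass d α * (e + B * ‖ζ‖)) < 2 * (2 * gaussMass d α * (2 * e)) := by gcongr
      _ = ε := by rw [he]; field_simp; norm_num

theorem heatOp_eq_heatFlow (t : ℝ≥0) (y : XSpace d α (zero_lt_one.trans hα))
    (x : EuclideanSpace ℝ (Fin d)) : heatOp hα (t : ℝ) y x = heatFlow d t y x := by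
  rcases eq_or_lt_of_le t.2 with h | h
  · have h0 : (t : ℝ) = 0 := h.symm
    rw [heatFlow, if_pos h0, h0, Complex.ofReal_zero, heatOp_zero]
    rfl
  · have h0 : (0 : ℝ) < t := h
    rw [heatFlow, if_neg h0.ne', heatOp_apply hα (ofReal_mem_timeCone hα h0), heatExt_toComplex]
    simp only [complexHeat_ofReal h0]

theorem isC0Semigroup_heatOp :
    IsC0Semigroup fun t : ℝ≥0 => heatOp (d := d) hα (t : ℝ) where
  map_zero := by simpa using heatOp_zero hα
  map_add s t := by
    rcases eq_or_ne s 0 with rfl | hs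
    · simp [heatOp_zero]
    rcases eq_or_ne t 0 with rfl | ht
    · simp [heatOp_zero]
    have hs' : (0 : ℝ) < s := by exact_mod_cast pos_iff_ne_zero.mpr hs
    have ht' : (0 : ℝ) < t := by exact_mod_cast pos_iff_ne_zero.mpr ht
    simp only [NNReal.coe_add, Complex.ofReal_add]
    exact heatOp_add hα (ofReal_mem_timeCone hα hs') (ofReal_mem_timeCone hα ht')
  continuous_orbit y := by
    have hc : Continuous fun t : ℝ≥0 => ((t : ℝ) : ℂ) :=
      Complex.continuous_ofReal.comp NNReal.continuous_coe
    refine continuous_iff_continuousAt.mpr fun t => ?_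
    rcases eq_or_ne t 0 with rfl | ht
    · have h1 : Tendsto (fun ζ => heatOp hα ζ y) (𝓝[insert 0 (timeCone α)] 0) (𝓝 y) := by
        rw [nhdsWithin_insert]
        refine Tendsto.sup ?_ (tendsto_heatOp hα y)
        rw [tendsto_pure_left]
        intro s hs
        rw [heatOp_zero]
        exact mem_of_mem_nhds hs
      have h2 : Tendsto (fun t : ℝ≥0 => ((t : ℝ) : ℂ)) (𝓝 0) (𝓝[insert 0 (timeCone α)] 0) := by
        refine tendsto_nhdsWithin_iff.mpr ⟨hc.tendsto' 0 0 (by simp), Eventually.of_forall ?_⟩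
        intro s
        rcases eq_or_ne s 0 with rfl | hs
        · left; simp
        · right
          exact ofReal_mem_timeCone hα (by exact_mod_cast pos_iff_ne_zero.mpr hs)
      have h3 : heatOp hα (((0 : ℝ≥0) : ℝ) : ℂ) y = y := by
        simp [heatOp_zero]
      rw [ContinuousAt, h3]
      exact h1.comp h2
    · have ht' : (0 : ℝ) < t := by exact_mod_cast pos_iff_ne_zero.mpr ht
      have h1 : ContinuousAt (heatOp (d := d) hα) ((t : ℝ) : ℂ) :=
        ((differentiableOn_heatOp hα).differentiableAt
          ((isOpen_timeCone α).mem_nhds (ofReal_mem_timeCone hα ht'))).continuousAt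
      have h2 : ContinuousAt (fun t : ℝ≥0 => heatOp (d := d) hα ((t : ℝ) : ℂ)) t :=
        ContinuousAt.comp_of_eq (x := t) (f := fun t : ℝ≥0 => ((t : ℝ) : ℂ)) h1 hc.continuousAt rfl
      exact h2.clm_apply continuousAt_const

theorem isAnalyticSemigroup_heatOp :
    IsAnalyticSemigroup fun t : ℝ≥0 => heatOp (d := d) hα (t : ℝ) where
  isC0Semigroup := isC0Semigroup_heatOp hα
  exists_extension := by
    have hsub := sector_subset_timeCone hα
    refine ⟨aperture α / 2, half_pos (aperture_pos hα), ?_, heatOp hα, fun _ => rfl,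
      fun z hz w hw => heatOp_add hα (hsub hz) (hsub hw), (differentiableOn_heatOp hα).mono hsub,
      fun θ' _ hθ' y => (tendsto_heatOp hα y).mono_left (nhdsWithin_mono 0 fun z hz =>
        hsub ⟨hz.1, hz.2.trans hθ'⟩)⟩
    have := aperture_lt_one α
    linarith [Real.pi_gt_three]

/-- The `j`-th partial derivative of the heat flow of an element of `X_α`. -/
def heatGrad {ζ : ℂ} (hζ : ζ ∈ timeCone α) (y : XSpace d α (zero_lt_one.trans hα)) (j : Fin d) :
    XSpace d α (zero_lt_one.trans hα) :=
  XSpace.ofEntire _ (fun z => fderiv ℂ (heatExt ζ y) z (EuclideanSpace.single j 1))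
    (differentiable_fderiv_apply (differentiable_heatExt hα hζ y.toBCF) _)
    ((tubeBounded_heatExt hα hζ y).fderiv_apply (differentiable_heatExt hα hζ y.toBCF) _)

theorem isGradient_heatGrad {ζ : ℂ} (hζ : ζ ∈ timeCone α)
    (y : XSpace d α (zero_lt_one.trans hα)) :
    IsGradient (heatOp hα ζ y) (heatGrad hα hζ y) := by
  have hF := differentiable_heatExt hα hζ y.toBCF
  have hfun : (heatOp hα ζ y : EuclideanSpace ℝ (Fin d) → ℂ) =
      fun x => heatExt ζ y (toComplex x) := funext fun x => heatOp_apply hα hζ y x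
  have hD := fun x => hasFDerivAt_comp_toComplex hF x
  refine ⟨?_, fun j x => ?_⟩
  · rw [hfun, contDiff_one_iff_fderiv]
    refine ⟨fun x => (hD x).differentiableAt, continuous_clm_apply.mpr fun v => ?_⟩
    have e : (fun x => fderiv ℝ (fun x => heatExt ζ y (toComplex x)) x v) =
        fun x => fderiv ℂ (heatExt ζ y) (toComplex x) (toComplex v) := by
      funext x
      exact congrArg (fun L => L v) (hD x).fderiv
    rw [e]
    exact (differentiable_fderiv_apply hF (toComplex v)).continuous.comp continuous_toComplex
  · rw [hfun, (hD x).fderiv]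
    have e : toComplex (EuclideanSpace.single j (1 : ℝ)) = EuclideanSpace.single j (1 : ℂ) := by
      ext i
      by_cases h : i = j <;> simp [toComplex, h]
    change fderiv ℂ (heatExt ζ y) (toComplex x) (EuclideanSpace.single j 1) =
      fderiv ℂ (heatExt ζ y) (toComplex x) (toComplex (EuclideanSpace.single j 1))
    rw [e]

/-- The gradient bound is Cauchy's estimate on balls of radius `√|ζ|`, on which the main estimate
controls the heat flow. -/
theorem norm_heatGrad_le {ζ : ℂ} (hζ : ζ ∈ timeCone α) (y : XSpace d α (zero_lt_one.trans hα))
    (j : Fin d) :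
    Real.sqrt ‖ζ‖ * ‖heatGrad hα hζ y j‖ ≤ 8 * gaussMass d α * ‖y‖ := by
  have hm := gaussMass_pos (d := d) hα
  have hs : 0 < Real.sqrt ‖ζ‖ := Real.sqrt_pos.mpr
    ((re_pos_of_mem_timeCone hα hζ).trans_le (Complex.re_le_norm ζ))
  have hb : ∀ z ∈ range toComplex ∪ Omega d α,
      ‖fderiv ℂ (heatExt ζ y) z (EuclideanSpace.single j 1)‖ ≤
        2 * (2 * gaussMass d α * ‖y‖) / Real.sqrt ‖ζ‖ := by
    intro z hz
    refine ((fderiv ℂ (heatExt ζ y) z).le_opNorm _).trans ?_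
    rw [PiLp.norm_single, norm_one, mul_one]
    exact norm_fderiv_le_of_forall_norm_le (differentiable_heatExt hα hζ y.toBCF) hs
      fun δ hδ => norm_heatExt_le hα hζ y hz hδ
  have h1 := (heatGrad hα hζ y j).norm_le_of_forall (by positivity)
    (fun x => hb _ (Or.inl ⟨x, rfl⟩)) fun z hz => by
      rw [heatGrad, XSpace.ext_ofEntire _ _ _ hz]
      exact hb z (Or.inr hz)
  calc Real.sqrt ‖ζ‖ * ‖heatGrad hα hζ y j‖
      ≤ Real.sqrt ‖ζ‖ * (2 * (2 * (2 * gaussMass d α * ‖y‖) / Real.sqrt ‖ζ‖)) := by gcongr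
    _ = 8 * gaussMass d α * ‖y‖ := by field_simp; ring

end Semigroup

end HeatHol

end

open HeatHol
theorem theorem2p2 (d : ℕ) (α : ℝ) (hα : 1 < α) :
    ∃ S : ℝ≥0 → XSpace d α (zero_lt_one.trans hα) →L[ℂ] XSpace d α (zero_lt_one.trans hα),
      (∀ t y x, S t y x = heatFlow d t y x) ∧
      IsAnalyticSemigroup S ∧
      ∃ C : ℝ, 0 < C ∧ ∀ t : ℝ≥0, 0 < t → ∀ y : XSpace d α (zero_lt_one.trans hα),
        ∃ g : Fin d → XSpace d α (zero_lt_one.trans hα),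
          IsGradient (S t y) g ∧
          ‖S t y‖ + Real.sqrt t * ∑ j, ‖g j‖ ≤ C * ‖y‖ := by
  have hm := gaussMass_pos (d := d) hα
  refine ⟨fun t => heatOp hα (t : ℝ), heatOp_eq_heatFlow hα, isAnalyticSemigroup_heatOp hα,
    (4 + d * 8) * gaussMass d α, by positivity, fun t ht y => ?_⟩
  have ht' : (0 : ℝ) < t := ht
  have hζ := ofReal_mem_timeCone hα ht'
  refine ⟨heatGrad hα hζ y, isGradient_heatGrad hα hζ y, ?_⟩
  have h1 := norm_heatOp_apply_le hα hζ y
  have h2 : Real.sqrt t * ∑ j, ‖heatGrad hα hζ y j‖ ≤ d * (8 * gaussMass d α * ‖y‖) := by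
    rw [Finset.mul_sum]
    refine (Finset.sum_le_card_nsmul _ _ (8 * gaussMass d α * ‖y‖) fun j _ => ?_).trans_eq (by simp)
    have h3 := norm_heatGrad_le hα hζ y j
    rwa [Complex.norm_real, Real.norm_of_nonneg ht'.le] at h3
  calc _ ≤ 4 * gaussMass d α * ‖y‖ + d * (8 * gaussMass d α * ‖y‖) := add_le_add h1 h2
    _ = _ := by ring
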